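/- Let $k\ge 3$ and let $\mathbb{B}$ be the Bethe lattice with coordination number $k$, i.e. a tree with vertex set $V$ in which every vertex has exactly $k$ neighbours; fix a root $0\in V$. Let $C\ge 0$ and $\Omega=[-C,C]^{V}$. For $\omega\in\Omega$ let $H_\omega$ be the bounded operator on $\ell^2(V)$ given by $$(H_\omega\psi)(x)=\sum_{y\sim x}\psi(y)+\omega_x\psi(x),$$ i.e. $H_\omega=\Delta_{\mathbb B}+\sum_x\omega_x\pi_x$ with $\pi_x=|\delta_x\rangle\langle\delta_x|$. For a Borel probability measure $\mu$ on $[-C,C]$ let $\mu^{(\infty)}=\bigotimes_{x\in V}\mu$ and $$n_\mu(f)=\mathbb{E}_{\mu^{(\infty)}}\{\mathrm{Tr}(\pi_0 f(H_\omega)\pi_0)\}.$$ For a real Lipschitz function $f$ on a compact interval $I$ put $\|f\|_{\mathrm{Lip}}=\|f\|_\infty+L_f$, where $L_f=\sup_{x\ne y\in I}|f(x)-f(y)|/|x-y|$ (and $L_f=0$ if $I$ is a single point). For Borel probability measures $\mu,\mu'$ on $[-C,C]$ put $d_w(\mu,\mu')=\sup\{|\mu(g)-\mu'(g)| : g\in\mathrm{Lip}([-C,C]),\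 \|g\|_{\mathrm{Lip}}\le 1\}$. Let $$r_{\mathbb B}=2\sqrt{k-1}+C,\quad \xi_0=\frac{2\mathrm e}{1+2\mathrm e},\quad c_b=\frac{4306+837\sqrt6}{5832},\quad \gamma_{\mathbb B}=2\bigl(2r_{\mathbb B}\,c_b\sqrt{\log k}+1\bigr).$$ **Theorem.** Let $(\nu_\alpha)_{\alpha\in\mathbb N}$ be Borel probability measures on $[-C,C]$ converging weak-$^*$ to a probability measure $\nu$ on $[-C,C]$, and put $\eta_\alpha=d_w(\nu_\alpha,\nu)$. Every $H_\omega$ is self-adjoint with $\sigma(H_\omega)\subseteq[-r_{\mathbb B},r_{\mathbb B}]$, and for every $f\in\mathrm{Lip}([-r_{\mathbb B},r_{\mathbb B}])$ and every Borel probability measure $\mu$ on $[-C,C]$ the function $\omega\mapsto\mathrm{Tr}(\pi_0f(H_\omega)\pi_0)$ is $\mu^{(\infty)}$-integrable, so that $n_\mu(f)$ is well defined. There exists $\alpha_{\mathbb B}\in\mathbb N$ such that $$\eta_\alpha\le \mathrm e^{-3\log(k)/\xi_0}\quad\text{for all }\alpha\ge\alpha_{\mathbb B},$$ and for every such $\alpha_{\mathbb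 B}$, every $f\in\mathrm{Lip}([-r_{\mathbb B},r_{\mathbb B}])$ and every $\alpha\ge\alpha_{\mathbb B}$, $$|n_{\nu_\alpha}(f)-n_\nu(f)|\le\frac{\gamma_{\mathbb B}\,\|f\|_{\mathrm{Lip}}}{\sqrt{\log\bigl(\eta_\alpha^{-2\mathrm e/(1+2\mathrm e)}\bigr)}},$$ where the right-hand side is read as $0$ if $\eta_\alpha=0$ (in which case $\nu_\alpha=\nu$). -/

import Mathlib

open MeasureTheory Filter Topology
open scoped ENNReal

noncomputable section

namespace BetheAnderson

/-- `G` is the Bethe lattice with coordination number `k`: a connected graph without cycles in which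
every vertex has exactly `k` neighbours. -/
structure IsBetheLattice {V : Type*} (G : SimpleGraph V) [G.LocallyFinite] (k : ℕ) : Prop where
  isTree : G.IsTree
  regular : G.IsRegularOfDegree k

/-- The continuous functional calculus `f(H)` of a bounded self-adjoint operator `H` on a complex
Hilbert space; it depends only on the values of `f` on the spectrum of `H`. -/
def opFun {E : Type*} [NormedAddCommGroup E] [InnerProductSpace ℂ E] [CompleteSpace E]
    (f : ℝ → ℝ) (H : E →L[ℂ] E) : E →L[ℂ] E := cfc f H

/-- The Hilbert space `ℓ²(V)` of square summable complex functions on the vertex set. -/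
abbrev ell2 (V : Type*) : Type _ := lp (fun _ : V => ℂ) 2

/-- The phase space `Ω = [-C, C]^V`. -/
abbrev Config (V : Type*) (C : ℝ) : Type _ := V → Set.Icc (-C) C

section Operators

variable {V : Type*}

theorem sum_sq_adj_le (G : SimpleGraph V) [G.LocallyFinite] {k : ℕ}
    (hG : G.IsRegularOfDegree k) (ψ : ell2 V) (s : Finset V) :
    ∑ x ∈ s, ‖∑ y ∈ G.neighborFinset x, ψ y‖ ^ (2 : ℝ≥0∞).toReal
      ≤ ((k : ℝ) * ‖ψ‖) ^ (2 : ℝ≥0∞).toReal := by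
  classical
  have h2 : (2 : ℝ≥0∞).toReal = ((2 : ℕ) : ℝ) := by simp
  have hcard : ∀ x, (G.neighborFinset x).card = k := fun x => by
    rw [SimpleGraph.card_neighborFinset_eq_degree]; exact hG x
  have hψ : ∀ t : Finset V, ∑ y ∈ t, ‖ψ y‖ ^ 2 ≤ ‖ψ‖ ^ 2 := fun t => by
    have := lp.sum_rpow_le_norm_rpow (p := 2) (by simp) ψ t
    simpa only [h2, Real.rpow_natCast] using this
  simp only [h2, Real.rpow_natCast]
  calc ∑ x ∈ s, ‖∑ y ∈ G.neighborFinset x, ψ y‖ ^ 2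
      ≤ ∑ x ∈ s, (k : ℝ) * ∑ y ∈ G.neighborFinset x, ‖ψ y‖ ^ 2 := by
        refine Finset.sum_le_sum fun x _ => ?_
        have h1 : ‖∑ y ∈ G.neighborFinset x, ψ y‖ ^ 2
            ≤ (∑ y ∈ G.neighborFinset x, ‖ψ y‖) ^ 2 := by
          gcongr
          exact norm_sum_le _ _
        have h3 := sq_sum_le_card_mul_sum_sq (s := G.neighborFinset x) (f := fun y => ‖ψ y‖)
        rw [hcard] at h3
        exact h1.trans h3
    _ = (k : ℝ) * ∑ x ∈ s, ∑ y ∈ G.neighborFinset x, ‖ψ y‖ ^ 2 := by rw [Finset.mul_sum]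
    _ = (k : ℝ) * ∑ y ∈ s.biUnion (fun x => G.neighborFinset x),
          ∑ _x ∈ s.filter (fun x => G.Adj x y), ‖ψ y‖ ^ 2 := by
        congr 1
        refine Finset.sum_comm' fun x y => ?_
        simp only [Finset.mem_biUnion, Finset.mem_filter, SimpleGraph.mem_neighborFinset]
        constructor
        · rintro ⟨hx, hxy⟩
          exact ⟨⟨hx, hxy⟩, x, hx, hxy⟩
        · rintro ⟨⟨hx, hxy⟩, _⟩
          exact ⟨hx, hxy⟩
    _ ≤ (k : ℝ) * ∑ y ∈ s.biUnion (fun x => G.neighborFinset x), (k : ℝ) * ‖ψ y‖ ^ 2 := by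
        gcongr with y _
        rw [Finset.sum_const, nsmul_eq_mul]
        gcongr
        rw [← hcard y]
        refine Finset.card_le_card fun x hx => ?_
        rw [SimpleGraph.mem_neighborFinset]
        exact (Finset.mem_filter.1 hx).2.symm
    _ = (k : ℝ) * k * ∑ y ∈ s.biUnion (fun x => G.neighborFinset x), ‖ψ y‖ ^ 2 := by
        rw [← Finset.mul_sum, mul_assoc]
    _ ≤ (k : ℝ) * k * ‖ψ‖ ^ 2 := by gcongr; exact hψ _
    _ = ((k : ℝ) * ‖ψ‖) ^ 2 := by ring

/-- The graph Laplacian `(Δ ψ)(x) = ∑_{y ∼ x} ψ(y)` as a bounded operator on `ℓ²(V)`. -/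
def laplacian (G : SimpleGraph V) [G.LocallyFinite] {k : ℕ} (hG : G.IsRegularOfDegree k) :
    ell2 V →L[ℂ] ell2 V :=
  LinearMap.mkContinuous
    { toFun := fun ψ =>
        ⟨fun x => ∑ y ∈ G.neighborFinset x, ψ y, memℓp_gen' (sum_sq_adj_le G hG ψ)⟩
      map_add' := fun ψ φ => by
        ext x
        exact Finset.sum_add_distrib
      map_smul' := fun c ψ => by
        ext x
        simp [Finset.mul_sum] }
    k
    (fun ψ => lp.norm_le_of_forall_sum_le (by simp) (by positivity) (sum_sq_adj_le G hG ψ))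

theorem laplacian_apply (G : SimpleGraph V) [G.LocallyFinite] {k : ℕ}
    (hG : G.IsRegularOfDegree k) (ψ : ell2 V) (x : V) :
    laplacian G hG ψ x = ∑ y ∈ G.neighborFinset x, ψ y := rfl

theorem sum_sq_mul_le {C : ℝ} (ω : Config V C) (ψ : ell2 V) (s : Finset V) :
    ∑ x ∈ s, ‖((ω x : ℝ) : ℂ) * ψ x‖ ^ (2 : ℝ≥0∞).toReal
      ≤ (|C| * ‖ψ‖) ^ (2 : ℝ≥0∞).toReal := by
  have h2 : (2 : ℝ≥0∞).toReal = ((2 : ℕ) : ℝ) := by simp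
  have hψ : ∑ y ∈ s, ‖ψ y‖ ^ 2 ≤ ‖ψ‖ ^ 2 := by
    have := lp.sum_rpow_le_norm_rpow (p := 2) (by simp) ψ s
    simpa only [h2, Real.rpow_natCast] using this
  simp only [h2, Real.rpow_natCast]
  calc ∑ x ∈ s, ‖((ω x : ℝ) : ℂ) * ψ x‖ ^ 2
      ≤ ∑ x ∈ s, |C| ^ 2 * ‖ψ x‖ ^ 2 := by
        refine Finset.sum_le_sum fun x _ => ?_
        rw [norm_mul, mul_pow, Complex.norm_real, Real.norm_eq_abs]
        have hC : |((ω x : ℝ))| ≤ |C| :=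
          (abs_le.2 ⟨(ω x).2.1, (ω x).2.2⟩).trans (le_abs_self C)
        gcongr
    _ = |C| ^ 2 * ∑ x ∈ s, ‖ψ x‖ ^ 2 := by rw [Finset.mul_sum]
    _ ≤ |C| ^ 2 * ‖ψ‖ ^ 2 := by gcongr
    _ = (|C| * ‖ψ‖) ^ 2 := by ring

/-- The random potential `∑ₓ ω_x π_x`, that is, multiplication by `ω` (see `hasSum_potential`). -/
def potential {C : ℝ} (ω : Config V C) : ell2 V →L[ℂ] ell2 V :=
  LinearMap.mkContinuous
    { toFun := fun ψ =>
        ⟨fun x => ((ω x : ℝ) : ℂ) * ψ x, memℓp_gen' (sum_sq_mul_le ω ψ)⟩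
      map_add' := fun ψ φ => by
        ext x
        exact mul_add _ _ _
      map_smul' := fun c ψ => by
        ext x
        simp [mul_left_comm] }
    |C|
    (fun ψ => lp.norm_le_of_forall_sum_le (by simp) (by positivity) (sum_sq_mul_le ω ψ))

theorem potential_apply {C : ℝ} (ω : Config V C) (ψ : ell2 V) (x : V) :
    potential ω ψ x = ((ω x : ℝ) : ℂ) * ψ x := rfl

open Classical in
/-- The standard basis vector `δ_x` of `ℓ²(V)`. -/
def delta (x : V) : ell2 V := lp.single 2 x (1 : ℂ)

/-- The orthogonal projection `π_x = |δ_x⟩⟨δ_x|`. -/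
def siteProj (x : V) : ell2 V →L[ℂ] ell2 V :=
  InnerProductSpace.rankOne ℂ (delta x) (delta x)

theorem inner_delta (x : V) (ψ : ell2 V) : inner ℂ (delta x) ψ = ψ x := by
  classical
  unfold delta
  rw [lp.inner_single_left]
  simp

/-- The series `∑ₓ ω_x π_x` converges strongly to the potential. -/
theorem hasSum_potential {C : ℝ} (ω : Config V C) (ψ : ell2 V) :
    HasSum (fun x => ((ω x : ℝ) : ℂ) • siteProj x ψ) (potential ω ψ) := by
  classical
  have h := lp.hasSum_single (p := 2) (by simp) (potential ω ψ)
  have e : (fun x => ((ω x : ℝ) : ℂ) • siteProj x ψ)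
      = fun x => lp.single 2 x (potential ω ψ x) := by
    funext x
    rw [siteProj, InnerProductSpace.rankOne_apply, inner_delta, potential_apply, smul_smul,
      delta, ← lp.single_smul, smul_eq_mul, mul_one]
  rw [e]
  exact h

/-- The Anderson Hamiltonian `H_ω = Δ + ∑ₓ ω_x π_x` on `ℓ²(V)`. -/
def hamiltonian (G : SimpleGraph V) [G.LocallyFinite] {k : ℕ} (hG : IsBetheLattice G k)
    {C : ℝ} (ω : Config V C) : ell2 V →L[ℂ] ell2 V :=
  laplacian G hG.regular + potential ω

/-- The trace `∑ₓ ⟨δ_x, T δ_x⟩` in the standard basis; it is only used for finite-rank `T`. -/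
def trace (T : ell2 V →L[ℂ] ell2 V) : ℂ := ∑' x, inner ℂ (delta x) (T (delta x))

/-- The spectral average `Tr (π_o f(H_ω) π_o)`. -/
def localTrace (G : SimpleGraph V) [G.LocallyFinite] {k : ℕ} (hG : IsBetheLattice G k)
    (o : V) {C : ℝ} (f : ℝ → ℝ) (ω : Config V C) : ℂ :=
  trace (siteProj o * opFun f (hamiltonian G hG ω) * siteProj o)

/-- The infinite product measure `ν^{(∞)}` on `Ω` of a single-site law `ν` on `[-C, C]`. -/
def productLaw (V : Type*) {C : ℝ} (ν : ProbabilityMeasure (Set.Icc (-C) C)) :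
    Measure (Config V C) :=
  Measure.infinitePi (fun _ : V => (ν : Measure (Set.Icc (-C) C)))

/-- The density of states measure of the single-site law `ν`, as a functional:
`n_ν(f) = 𝔼 Tr (π_o f(H_ω) π_o)`. -/
def dos (G : SimpleGraph V) [G.LocallyFinite] {k : ℕ} (hG : IsBetheLattice G k)
    (o : V) {C : ℝ} (ν : ProbabilityMeasure (Set.Icc (-C) C)) (f : ℝ → ℝ) : ℂ :=
  ∫ ω, localTrace G hG o f ω ∂(productLaw V ν)

end Operators

/-- `f` is Lipschitz (with some constant). -/
def IsLip {X : Type*} [MetricSpace X] (f : X → ℝ) : Prop := ∃ K, LipschitzWith K f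

/-- The norm `‖f‖_Lip = ‖f‖_∞ + L_f` of a bounded Lipschitz function, with `L_f` its smallest
Lipschitz constant (pairs with `x = y` contribute `0 / 0 = 0`). -/
def lipNorm {X : Type*} [MetricSpace X] (f : X → ℝ) : ℝ :=
  (⨆ x, |f x|) + ⨆ p : X × X, |f p.1 - f p.2| / dist p.1 p.2

/-- The Lipschitz-dual metric `d_w(μ, ν) = sup {|μ(f) - ν(f)| : ‖f‖_Lip ≤ 1}`. -/
def dw {X : Type*} [MetricSpace X] [MeasurableSpace X] (μ ν : ProbabilityMeasure X) : ℝ :=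
  sSup {t | ∃ f : X → ℝ, IsLip f ∧ lipNorm f ≤ 1 ∧
    t = |(∫ x, f x ∂(μ : Measure X)) - ∫ x, f x ∂(ν : Measure X)|}

/-- The bound `r_𝔹 = 2 √(k - 1) + C`. -/
def rB (k : ℕ) (C : ℝ) : ℝ := 2 * Real.sqrt ((k : ℝ) - 1) + C

/-- The interval `[-r_𝔹, r_𝔹]`, which contains the spectrum of every `H_ω`. -/
abbrev energies (k : ℕ) (C : ℝ) : Set ℝ := Set.Icc (-rB k C) (rB k C)

/-- The exponent `ξ₀ = 2e / (1 + 2e)`. -/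
def xi0 : ℝ := 2 * Real.exp 1 / (1 + 2 * Real.exp 1)

/-- The optimal constant in the uniform approximation by Bernstein polynomials. -/
def bernsteinConst : ℝ := (4306 + 837 * Real.sqrt 6) / 5832

/-- The constant `γ_𝔹 = 2 (2 r_𝔹 c_b √(log k) + 1)`. -/
def gammaB (k : ℕ) (C : ℝ) : ℝ :=
  2 * (2 * rB k C * bernsteinConst * Real.sqrt (Real.log k) + 1)

end BetheAnderson

end

/-! The local average `⟨δ_o, f(H_ω) δ_o⟩` becomes a function of finitely many coordinates once `f`
is replaced by a polynomial, and such a function can be compared under two product laws by changing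
one site at a time.

Let `r = r_𝔹`, `S = ‖f‖_∞`, `L = L_f`, `η = dw ν' ν`, and let `p` be the Bernstein polynomial of `f`
on `[-r, r]` of degree `n = m + 1`. Since all spectra lie in `[-r, r]`, the replacement costs at
most `L r / √n`, uniformly in `ω` (`abs_siteAverage_sub_bernstein_le`). The average of `p` has three
properties: it sees only the ball of radius `m`, with at most `(k + 1) ^ m` sites
(`dependsOn_siteAverage_polynomial`); it is bounded by `S`; it is Lipschitz in each coordinate with
constant `S n 2 ^ n / (2 r)` (`norm_aeval_bernsteinApprox_sub_le`). Each change of a single-site law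
thus costs at most sup bound plus Lipschitz constant, times `η` (`abs_integral_familyLaw_sub_le`),
and altogether the difference is at most `2 L r / √n + (k + 1) ^ m S (1 + n 2 ^ n / (2 r)) η`.

With `T = log (η ^ (-ξ₀))`, the choice `n = ⌈T / (4 log k)⌉` makes both terms of order `1 / √T`
(`exists_degree`). The spectral bound comes from a Schur test with a radial weight on the tree
(`norm_laplacian_le`), and the threshold exists because weak convergence forces `dw → 0`
(`tendsto_dw`). -/

noncomputable section

namespace BetheAnderson

/-! ### Distances and a radial weight on the tree. -/

section Tree

variable {V : Type*} {G : SimpleGraph V}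

/-- In a tree, a vertex has at most one neighbour that is not farther from the root. -/
theorem eq_of_adj_of_dist_le (hG : G.IsTree) (o : V) {x y z : V} (hy : G.Adj x y) (hz : G.Adj x z)
    (hyd : G.dist o y ≤ G.dist o x) (hzd : G.dist o z ≤ G.dist o x) : y = z := by
  -- Adjacent vertices of a tree have different distances from `o`, so `w` is exactly one step
  -- closer and a geodesic to `w` extends to one to `x`. Uniqueness of paths then determines `w`.
  have key : ∀ w, G.Adj x w → G.dist o w ≤ G.dist o x →
      ∃ p : G.Walk o x, p.IsPath ∧ p.penultimate = w := by
    intro w hw hwd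
    obtain ⟨p, hp⟩ := hG.connected.exists_walk_length_eq_dist o w
    have hne := hG.dist_ne_of_adj o hw
    have htri : G.dist o x ≤ G.dist o w + 1 := by
      have := hG.connected.dist_triangle (u := o) (v := w) (w := x)
      rwa [SimpleGraph.dist_eq_one_iff_adj.2 hw.symm] at this
    refine ⟨p.concat hw.symm, (p.concat hw.symm).isPath_of_length_eq_dist ?_, by simp⟩
    rw [SimpleGraph.Walk.length_concat]
    omega
  obtain ⟨p, hp, rfl⟩ := key y hy hyd
  obtain ⟨q, hq, rfl⟩ := key z hz hzd
  have := (hG.isAcyclic.subsingleton_path o x).elim ⟨p, hp⟩ ⟨q, hq⟩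
  rw [Subtype.mk.injEq] at this
  rw [this]

/-- The radial weight `q ^ (-dist(o, x))`, `q = √(k - 1)`, is a positive supersolution of the
eigenvalue equation `Δ φ = 2 √(k - 1) φ`. -/
theorem sum_radial_weight_le [G.LocallyFinite] {k : ℕ} (hk : 3 ≤ k) (hG : IsBetheLattice G k)
    (o x : V) :
    ∑ y ∈ G.neighborFinset x, (Real.sqrt ((k : ℝ) - 1))⁻¹ ^ G.dist o y
      ≤ 2 * Real.sqrt ((k : ℝ) - 1) * (Real.sqrt ((k : ℝ) - 1))⁻¹ ^ G.dist o x := by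
  classical
  have hk' : (3 : ℝ) ≤ k := by exact_mod_cast hk
  set q := Real.sqrt ((k : ℝ) - 1) with hq
  have hq1 : 1 ≤ q := by rw [hq, Real.one_le_sqrt]; linarith
  have hq0 : 0 < q := by linarith
  have hqq : q * q = k - 1 := Real.mul_self_sqrt (by linarith)
  have hqi : q⁻¹ ≤ 1 := inv_le_one_of_one_le₀ hq1
  have hqi0 : 0 < q⁻¹ := inv_pos.2 hq0
  set d := G.dist o x with hd
  have hcard : (G.neighborFinset x).card = k := by
    rw [SimpleGraph.card_neighborFinset_eq_degree]; exact hG.regular x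
  set A := (G.neighborFinset x).filter (fun y => G.dist o y ≤ d) with hA
  have hA1 : A.card ≤ 1 := by
    refine Finset.card_le_one.2 fun y hy z hz => ?_
    simp only [hA, Finset.mem_filter, SimpleGraph.mem_neighborFinset] at hy hz
    exact eq_of_adj_of_dist_le hG.isTree o hy.1 hz.1 hy.2 hz.2
  have hnear : ∑ y ∈ A, q⁻¹ ^ G.dist o y ≤ A.card * (q * q⁻¹ ^ d) := by
    rw [← nsmul_eq_mul]
    refine Finset.sum_le_card_nsmul _ _ _ fun y hy => ?_
    simp only [hA, Finset.mem_filter, SimpleGraph.mem_neighborFinset] at hy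
    have htri : d ≤ G.dist o y + 1 := by
      have := hG.isTree.connected.dist_triangle (u := o) (v := y) (w := x)
      rwa [SimpleGraph.dist_eq_one_iff_adj.2 hy.1.symm] at this
    have h1 : q⁻¹ ^ (G.dist o y + 1) ≤ q⁻¹ ^ d := pow_le_pow_of_le_one hqi0.le hqi htri
    calc q⁻¹ ^ G.dist o y = q * q⁻¹ ^ (G.dist o y + 1) := by rw [pow_succ]; field_simp
      _ ≤ q * q⁻¹ ^ d := by gcongr
  have hfar : ∑ y ∈ (G.neighborFinset x).filter (fun y => ¬ G.dist o y ≤ d), q⁻¹ ^ G.dist o y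
      ≤ (k - A.card : ℝ) * (q⁻¹ * q⁻¹ ^ d) := by
    have hc : (((G.neighborFinset x).filter (fun y => ¬ G.dist o y ≤ d)).card : ℝ)
        = k - A.card := by
      have := Finset.card_filter_add_card_filter_not (s := G.neighborFinset x)
        (fun y => G.dist o y ≤ d)
      rw [hcard] at this
      rw [← this]; push_cast; ring
    rw [← hc, ← nsmul_eq_mul]
    refine Finset.sum_le_card_nsmul _ _ _ fun y hy => ?_
    simp only [Finset.mem_filter, not_le] at hy
    rw [← pow_succ']
    exact pow_le_pow_of_le_one hqi0.le hqi hy.2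
  rw [← Finset.sum_filter_add_sum_filter_not _ (fun y => G.dist o y ≤ d)]
  refine (add_le_add hnear hfar).trans ?_
  have hP : 0 < q⁻¹ ^ d := by positivity
  have hA1' : (A.card : ℝ) ≤ 1 := by exact_mod_cast hA1
  have hkq : (k : ℝ) * q⁻¹ = q + q⁻¹ := by
    have : (k : ℝ) = q * q + 1 := by linarith
    rw [this]; field_simp
  -- With `k q⁻¹ = q + q⁻¹` this reads `(A.card - 1) (q - q⁻¹) ≤ 0`. At the root `A` is empty and
  -- the inequality can be strict.
  have : (A.card : ℝ) * q + (k - A.card) * q⁻¹ ≤ 2 * q := by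
    rw [sub_mul, hkq]
    nlinarith
  calc _ = ((A.card : ℝ) * q + (k - A.card) * q⁻¹) * q⁻¹ ^ d := by ring
    _ ≤ _ := by gcongr

end Tree

/-! ### Norm, self-adjointness and spectrum of the Hamiltonian. -/

section Operators

variable {V : Type*} (G : SimpleGraph V) [G.LocallyFinite] {k : ℕ}

/-- The Schur test for the adjacency operator. -/
theorem norm_laplacian_le_of_weight (hG : G.IsRegularOfDegree k) {φ : V → ℝ} {c : ℝ}
    (hφ : ∀ x, 0 < φ x) (hc : 0 ≤ c) (hsum : ∀ x, ∑ y ∈ G.neighborFinset x, φ y ≤ c * φ x) :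
    ‖laplacian G hG‖ ≤ c := by
  classical
  refine ContinuousLinearMap.opNorm_le_bound _ hc fun ψ => ?_
  refine lp.norm_le_of_forall_sum_le (by simp) (by positivity) fun s => ?_
  have h2 : (2 : ℝ≥0∞).toReal = ((2 : ℕ) : ℝ) := by simp
  have hψ : ∀ t : Finset V, ∑ y ∈ t, ‖ψ y‖ ^ 2 ≤ ‖ψ‖ ^ 2 := fun t => by
    have := lp.sum_rpow_le_norm_rpow (p := 2) (by simp) ψ t
    simpa only [h2, Real.rpow_natCast] using this
  simp only [h2, Real.rpow_natCast, laplacian_apply]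
  calc ∑ x ∈ s, ‖∑ y ∈ G.neighborFinset x, ψ y‖ ^ 2
      ≤ ∑ x ∈ s, ∑ y ∈ G.neighborFinset x, c * φ x * (‖ψ y‖ ^ 2 / φ y) := by
        refine Finset.sum_le_sum fun x _ => ?_
        calc ‖∑ y ∈ G.neighborFinset x, ψ y‖ ^ 2
            ≤ (∑ y ∈ G.neighborFinset x, ‖ψ y‖) ^ 2 := by
              gcongr
              exact norm_sum_le _ _
          -- Cauchy–Schwarz for `‖ψ y‖ = √(φ y) · (‖ψ y‖ / √(φ y))`. The weight condition is used
          -- once here at `x`, and once more at `y` after the sums are exchanged.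
          _ ≤ (∑ y ∈ G.neighborFinset x, φ y) * ∑ y ∈ G.neighborFinset x, ‖ψ y‖ ^ 2 / φ y := by
              refine Finset.sum_sq_le_sum_mul_sum_of_sq_le_mul _ (fun y _ => (hφ y).le)
                (fun y _ => div_nonneg (sq_nonneg _) (hφ y).le) fun y _ => ?_
              have := (hφ y).ne'
              refine le_of_eq ?_
              field_simp
          _ ≤ (c * φ x) * ∑ y ∈ G.neighborFinset x, ‖ψ y‖ ^ 2 / φ y :=
              mul_le_mul_of_nonneg_right (hsum x)
                (Finset.sum_nonneg fun y _ => div_nonneg (sq_nonneg _) (hφ y).le)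
          _ = _ := by rw [Finset.mul_sum]
    _ = ∑ y ∈ s.biUnion (fun x => G.neighborFinset x),
          ∑ x ∈ s.filter (fun x => G.Adj x y), c * φ x * (‖ψ y‖ ^ 2 / φ y) := by
        refine Finset.sum_comm' fun x y => ?_
        simp only [Finset.mem_biUnion, Finset.mem_filter, SimpleGraph.mem_neighborFinset]
        constructor
        · rintro ⟨hx, hxy⟩
          exact ⟨⟨hx, hxy⟩, x, hx, hxy⟩
        · rintro ⟨⟨hx, hxy⟩, _⟩
          exact ⟨hx, hxy⟩
    _ ≤ ∑ y ∈ s.biUnion (fun x => G.neighborFinset x), c ^ 2 * ‖ψ y‖ ^ 2 := by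
        refine Finset.sum_le_sum fun y _ => ?_
        have hy := hφ y
        have h1 : ∑ x ∈ s.filter (fun x => G.Adj x y), φ x ≤ c * φ y := by
          refine (Finset.sum_le_sum_of_subset_of_nonneg ?_ fun x _ _ => (hφ x).le).trans (hsum y)
          intro x hx
          rw [SimpleGraph.mem_neighborFinset]
          exact (Finset.mem_filter.1 hx).2.symm
        rw [← Finset.sum_mul, ← Finset.mul_sum]
        calc c * (∑ x ∈ s.filter (fun x => G.Adj x y), φ x) * (‖ψ y‖ ^ 2 / φ y)
            ≤ c * (c * φ y) * (‖ψ y‖ ^ 2 / φ y) := by gcongr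
          _ = c ^ 2 * ‖ψ y‖ ^ 2 := by field_simp
    _ ≤ c ^ 2 * ‖ψ‖ ^ 2 := by rw [← Finset.mul_sum]; gcongr; exact hψ _
    _ = (c * ‖ψ‖) ^ 2 := by ring

theorem norm_laplacian_le (hk : 3 ≤ k) (hG : IsBetheLattice G k) :
    ‖laplacian G hG.regular‖ ≤ 2 * Real.sqrt ((k : ℝ) - 1) := by
  obtain ⟨o⟩ := hG.isTree.connected.nonempty
  have hk' : (3 : ℝ) ≤ k := by exact_mod_cast hk
  have : 0 < Real.sqrt ((k : ℝ) - 1) := Real.sqrt_pos.2 (by linarith)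
  exact norm_laplacian_le_of_weight G hG.regular
    (φ := fun x => (Real.sqrt ((k : ℝ) - 1))⁻¹ ^ G.dist o x) (fun x => by positivity)
    (by positivity) (sum_radial_weight_le hk hG o)

variable {C : ℝ}

theorem norm_potential_le (hC : 0 ≤ C) (ω : Config V C) : ‖potential ω‖ ≤ C := by
  refine (LinearMap.mkContinuous_norm_le _ (abs_nonneg C) _).trans_eq (abs_of_nonneg hC)

theorem norm_hamiltonian_le (hk : 3 ≤ k) (hG : IsBetheLattice G k) (hC : 0 ≤ C)
    (ω : Config V C) : ‖hamiltonian G hG ω‖ ≤ rB k C :=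
  (norm_add_le _ _).trans (add_le_add (norm_laplacian_le G hk hG) (norm_potential_le hC ω))

theorem delta_apply_self (x : V) : delta x x = 1 := by
  classical
  simp [delta]

theorem delta_apply_of_ne {x y : V} (h : y ≠ x) : delta x y = 0 := by
  classical
  simp [delta, Pi.single_eq_of_ne h]

theorem norm_delta (x : V) : ‖delta x‖ = 1 := by
  classical
  rw [delta, lp.norm_single (by simp)]
  simp

theorem hamiltonian_apply (hG : IsBetheLattice G k) (ω : Config V C) (ψ : ell2 V) (x : V) :
    hamiltonian G hG ω ψ x = ∑ y ∈ G.neighborFinset x, ψ y + ((ω x : ℝ) : ℂ) * ψ x := rfl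

theorem hamiltonian_delta (hG : IsBetheLattice G k) (ω : Config V C) (x : V) :
    hamiltonian G hG ω (delta x) =
      ∑ y ∈ G.neighborFinset x, delta y + ((ω x : ℝ) : ℂ) • delta x := by
  classical
  ext z
  have hcoe : ∀ y, (delta y : ell2 V) z = if z = y then 1 else 0 := fun y => by
    split_ifs with h
    · rw [h, delta_apply_self]
    · exact delta_apply_of_ne h
  rw [hamiltonian_apply, lp.coeFn_add, Pi.add_apply, lp.coeFn_smul, Pi.smul_apply, lp.coeFn_sum,
    Finset.sum_apply]
  simp only [hcoe, smul_eq_mul]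
  have hcoe' : ∀ y, (delta x : ell2 V) y = if y = x then 1 else 0 := fun y => by
    split_ifs with h
    · rw [h, delta_apply_self]
    · exact delta_apply_of_ne h
  simp only [hcoe', Finset.sum_ite_eq, Finset.sum_ite_eq', SimpleGraph.mem_neighborFinset]
  congr 1
  · simp only [G.adj_comm]
  · split_ifs with h
    · rw [h]
    · simp

/-- The coefficient of the adjoint at `x` is the pairing with `H δ_x`, so the explicit column
`hamiltonian_delta` suffices. -/
theorem isSelfAdjoint_hamiltonian (hG : IsBetheLattice G k) (ω : Config V C) :
    IsSelfAdjoint (hamiltonian G hG ω) := by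
  rw [ContinuousLinearMap.isSelfAdjoint_iff']
  refine ContinuousLinearMap.ext fun ψ => ?_
  ext x
  rw [← inner_delta, ContinuousLinearMap.adjoint_inner_right, hamiltonian_delta,
    hamiltonian_apply, inner_add_left, sum_inner, inner_smul_left]
  simp [inner_delta]

theorem abs_le_of_mem_spectrum_real {A : Type*} [NormedRing A] [NormedAlgebra ℝ A]
    [CompleteSpace A] [NormOneClass A] {a : A} {r x : ℝ} (ha : ‖a‖ ≤ r) (hx : x ∈ spectrum ℝ a) :
    x ∈ Set.Icc (-r) r :=
  abs_le.1 ((spectrum.norm_le_norm_of_mem hx).trans ha)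

instance nontrivial_ell2 [Nonempty V] : Nontrivial (ell2 V) :=
  ⟨⟨delta (Classical.arbitrary V), 0, fun h => by
    have := norm_delta (Classical.arbitrary V)
    rw [h, norm_zero] at this
    exact zero_ne_one this⟩⟩

theorem spectrum_real_hamiltonian_subset (hk : 3 ≤ k) (hG : IsBetheLattice G k) (hC : 0 ≤ C)
    (ω : Config V C) : spectrum ℝ (hamiltonian G hG ω) ⊆ energies k C := by
  have := hG.isTree.connected.nonempty
  exact fun x hx => abs_le_of_mem_spectrum_real (norm_hamiltonian_le G hk hG hC ω) hx

theorem spectrum_hamiltonian_subset (hk : 3 ≤ k) (hG : IsBetheLattice G k) (hC : 0 ≤ C)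
    (ω : Config V C) :
    spectrum ℂ (hamiltonian G hG ω) ⊆ Complex.ofReal '' energies k C := by
  intro z hz
  have hre := (isSelfAdjoint_hamiltonian G hG ω).mem_spectrum_eq_re hz
  refine ⟨z.re, spectrum_real_hamiltonian_subset G hk hG hC ω ?_, hre.symm⟩
  rw [← spectrum.preimage_algebraMap ℂ, Set.mem_preimage]
  rw [hre] at hz
  exact hz

theorem trace_siteProj (o : V) (T : ell2 V →L[ℂ] ell2 V) :
    trace (siteProj o * T * siteProj o) = inner ℂ (delta o) (T (delta o)) := by
  have hval : ∀ x, (siteProj o * T * siteProj o) (delta x)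
      = (inner ℂ (delta o) (delta x) * inner ℂ (delta o) (T (delta o)) : ℂ) • delta o := by
    intro x
    simp only [mul_apply_eq_comp, siteProj, InnerProductSpace.rankOne_apply, map_smul, smul_smul]
  rw [trace, tsum_eq_single o]
  · rw [hval, inner_smul_right, inner_delta o (delta o), delta_apply_self, one_mul, mul_one]
  · intro x hx
    rw [hval, inner_smul_right, inner_delta x, delta_apply_of_ne hx, mul_zero]

end Operators

/-! ### Bernstein approximation, for functions and in normed algebras. -/

section Bernstein

open Polynomial

/-- The Bernstein polynomial of degree `n` of `f` on the interval `[-r, r]`. -/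
def bernsteinApprox (f : ℝ → ℝ) (r : ℝ) (n : ℕ) : ℝ[X] :=
  ∑ j ∈ Finset.range (n + 1), C (f (2 * r * (j / n) - r)) *
    (bernsteinPolynomial ℝ n j).comp (C (1 / (2 * r)) * X + C (1 / 2))

theorem eval_bernsteinApprox (f : ℝ → ℝ) (r : ℝ) (n : ℕ) (x : ℝ) :
    (bernsteinApprox f r n).eval x = ∑ j ∈ Finset.range (n + 1), f (2 * r * (j / n) - r) *
      (bernsteinPolynomial ℝ n j).eval (1 / (2 * r) * x + 1 / 2) := by
  simp [bernsteinApprox, eval_finsetSum]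

theorem eval_bernsteinPolynomial_nonneg (n j : ℕ) {u : ℝ} (hu : u ∈ Set.Icc (0 : ℝ) 1) :
    0 ≤ (bernsteinPolynomial ℝ n j).eval u := by
  have h0 := hu.1
  have h1 : 0 ≤ 1 - u := sub_nonneg.2 hu.2
  simp only [bernsteinPolynomial, eval_mul, eval_natCast, eval_pow, eval_X, eval_sub, eval_one]
  positivity

theorem sum_eval_bernsteinPolynomial (n : ℕ) (u : ℝ) :
    ∑ j ∈ Finset.range (n + 1), (bernsteinPolynomial ℝ n j).eval u = 1 := by
  rw [← eval_finsetSum, bernsteinPolynomial.sum, eval_one]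

theorem sum_sq_mul_eval_bernsteinPolynomial (n : ℕ) (u : ℝ) :
    ∑ j ∈ Finset.range (n + 1), (n * u - j) ^ 2 * (bernsteinPolynomial ℝ n j).eval u
      = n * u * (1 - u) := by
  have := congrArg (eval u) (bernsteinPolynomial.variance ℝ n)
  simpa [eval_finsetSum] using this

/-- Cauchy–Schwarz bounds the mean absolute deviation of a binomial frequency by its standard
deviation, and the variance is `u (1 - u) / n ≤ 1 / (4 n)`. -/
theorem sum_abs_mul_eval_bernsteinPolynomial_le {n : ℕ} (hn : 0 < n) {u : ℝ}
    (hu : u ∈ Set.Icc (0 : ℝ) 1) :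
    ∑ j ∈ Finset.range (n + 1), |u - j / n| * (bernsteinPolynomial ℝ n j).eval u
      ≤ 1 / (2 * Real.sqrt n) := by
  have hn' : (0 : ℝ) < n := by exact_mod_cast hn
  set b : ℕ → ℝ := fun j => (bernsteinPolynomial ℝ n j).eval u with hb
  have hb0 : ∀ j, 0 ≤ b j := fun j => eval_bernsteinPolynomial_nonneg n j hu
  have hcs : (∑ j ∈ Finset.range (n + 1), |u - j / n| * b j) ^ 2
      ≤ (∑ j ∈ Finset.range (n + 1), (u - j / n) ^ 2 * b j) *
        ∑ j ∈ Finset.range (n + 1), b j := by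
    refine Finset.sum_sq_le_sum_mul_sum_of_sq_le_mul _
      (fun j _ => mul_nonneg (sq_nonneg _) (hb0 j)) (fun j _ => hb0 j) fun j _ => ?_
    rw [mul_pow, sq_abs]; exact le_of_eq (by ring)
  have hvar : ∑ j ∈ Finset.range (n + 1), (u - j / n) ^ 2 * b j = u * (1 - u) / n := by
    have h := sum_sq_mul_eval_bernsteinPolynomial n u
    have : ∀ j : ℕ, (u - j / n) ^ 2 * b j = (n * u - j) ^ 2 * b j / n ^ 2 := fun j => by
      field_simp
    simp only [this]
    rw [← Finset.sum_div, h]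
    field_simp
  rw [hvar, sum_eval_bernsteinPolynomial, mul_one] at hcs
  have hs : 0 < Real.sqrt n := Real.sqrt_pos.2 hn'
  refine abs_le_of_sq_le_sq' (hcs.trans ?_) (by positivity) |>.2
  rw [div_pow, mul_pow, Real.sq_sqrt hn'.le, div_le_div_iff₀ hn' (by positivity)]
  nlinarith [sq_nonneg (u - 1 / 2)]

theorem rescale_mem_Icc {r x : ℝ} (hr : 0 < r) (hx : x ∈ Set.Icc (-r) r) :
    1 / (2 * r) * x + 1 / 2 ∈ Set.Icc (0 : ℝ) 1 := by
  have h : 1 / (2 * r) * x + 1 / 2 = (x + r) / (2 * r) := by field_simp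
  rw [h]
  exact ⟨div_nonneg (by linarith [hx.1]) (by linarith),
    (div_le_one (by linarith)).2 (by linarith [hx.2])⟩

theorem node_mem_Icc {r : ℝ} (hr : 0 < r) {n j : ℕ} (hj : j ∈ Finset.range (n + 1)) :
    2 * r * (j / n) - r ∈ Set.Icc (-r) r := by
  have h0 : (0 : ℝ) ≤ j / n := by positivity
  have h1 : (j : ℝ) / n ≤ 1 :=
    div_le_one_of_le₀ (by exact_mod_cast Finset.mem_range_succ_iff.1 hj) (by positivity)
  constructor <;> nlinarith

/-- The approximant averages `f` over binomially distributed nodes centred at `x`, so the error is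
at most `K` times their mean deviation. The interval length `2 r` absorbs the `1 / 2` of the
previous bound. -/
theorem abs_sub_eval_bernsteinApprox_le {f : ℝ → ℝ} {r K : ℝ} (hr : 0 < r) (hK : 0 ≤ K)
    (hf : ∀ x ∈ Set.Icc (-r) r, ∀ y ∈ Set.Icc (-r) r, |f x - f y| ≤ K * |x - y|)
    {n : ℕ} (hn : 0 < n) {x : ℝ} (hx : x ∈ Set.Icc (-r) r) :
    |f x - (bernsteinApprox f r n).eval x| ≤ K * r / Real.sqrt n := by
  have hn' : (0 : ℝ) < n := by exact_mod_cast hn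
  have hu := rescale_mem_Icc hr hx
  rw [eval_bernsteinApprox]
  set u := 1 / (2 * r) * x + 1 / 2 with hudef
  have hxu : x = 2 * r * u - r := by rw [hudef]; field_simp; ring
  have hb0 : ∀ j, 0 ≤ (bernsteinPolynomial ℝ n j).eval u :=
    fun j => eval_bernsteinPolynomial_nonneg n j hu
  have hone := sum_eval_bernsteinPolynomial n u
  calc |f x - ∑ j ∈ Finset.range (n + 1), f (2 * r * (j / n) - r) *
          (bernsteinPolynomial ℝ n j).eval u|
      = |∑ j ∈ Finset.range (n + 1), (f x - f (2 * r * (j / n) - r)) *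
          (bernsteinPolynomial ℝ n j).eval u| := by
        simp only [sub_mul, Finset.sum_sub_distrib, ← Finset.mul_sum, hone, mul_one]
    _ ≤ ∑ j ∈ Finset.range (n + 1), |f x - f (2 * r * (j / n) - r)| *
          (bernsteinPolynomial ℝ n j).eval u := by
        refine (Finset.abs_sum_le_sum_abs _ _).trans_eq (Finset.sum_congr rfl fun j _ => ?_)
        rw [abs_mul, abs_of_nonneg (hb0 j)]
    _ ≤ ∑ j ∈ Finset.range (n + 1), K * (2 * r) * (|u - j / n| *
          (bernsteinPolynomial ℝ n j).eval u) := by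
        refine Finset.sum_le_sum fun j hj => ?_
        have h1 := hf x hx _ (node_mem_Icc hr hj)
        have h2 : x - (2 * r * (j / n) - r) = 2 * r * (u - j / n) := by rw [hxu]; ring
        rw [h2, abs_mul, abs_of_pos (by positivity : 0 < 2 * r)] at h1
        calc _ ≤ K * (2 * r * |u - j / n|) * (bernsteinPolynomial ℝ n j).eval u :=
              mul_le_mul_of_nonneg_right h1 (hb0 j)
          _ = _ := by ring
    _ ≤ K * (2 * r) * (1 / (2 * Real.sqrt n)) := by
        rw [← Finset.mul_sum]
        exact mul_le_mul_of_nonneg_left (sum_abs_mul_eval_bernsteinPolynomial_le hn hu)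
          (by positivity)
    _ = K * r / Real.sqrt n := by field_simp

theorem abs_eval_bernsteinApprox_le {f : ℝ → ℝ} {r S : ℝ} (hr : 0 < r)
    (hf : ∀ x ∈ Set.Icc (-r) r, |f x| ≤ S) (n : ℕ) {x : ℝ} (hx : x ∈ Set.Icc (-r) r) :
    |(bernsteinApprox f r n).eval x| ≤ S := by
  have hb0 : ∀ j, 0 ≤ (bernsteinPolynomial ℝ n j).eval (1 / (2 * r) * x + 1 / 2) :=
    fun j => eval_bernsteinPolynomial_nonneg n j (rescale_mem_Icc hr hx)
  rw [eval_bernsteinApprox]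
  refine (Finset.abs_sum_le_sum_abs _ _).trans ?_
  calc _ ≤ ∑ j ∈ Finset.range (n + 1),
        S * (bernsteinPolynomial ℝ n j).eval (1 / (2 * r) * x + 1 / 2) := by
        refine Finset.sum_le_sum fun j hj => ?_
        rw [abs_mul, abs_of_nonneg (hb0 j)]
        exact mul_le_mul_of_nonneg_right (hf _ (node_mem_Icc hr hj)) (hb0 j)
    _ = S := by rw [← Finset.mul_sum, sum_eval_bernsteinPolynomial, mul_one]

theorem natDegree_bernsteinApprox_le (f : ℝ → ℝ) (r : ℝ) (n : ℕ) :
    (bernsteinApprox f r n).natDegree ≤ n := by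
  refine natDegree_sum_le_of_forall_le _ _ fun j hj => ?_
  refine natDegree_C_mul_le _ _ |>.trans ?_
  refine natDegree_comp_le.trans ?_
  have h1 : (C (1 / (2 * r)) * X + C (1 / 2) : ℝ[X]).natDegree ≤ 1 := natDegree_linear_le
  have h2 : (bernsteinPolynomial ℝ n j).natDegree ≤ n := by
    have hj' := Finset.mem_range_succ_iff.1 hj
    have : (1 - X : ℝ[X]).natDegree ≤ 1 :=
      (natDegree_sub_le _ _).trans (by simp)
    rw [bernsteinPolynomial]
    refine natDegree_mul_le.trans ?_
    have h3 : ((n.choose j : ℝ[X]) * X ^ j).natDegree ≤ j := by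
      refine natDegree_mul_le.trans ?_
      simp
    have h4 : ((1 - X : ℝ[X]) ^ (n - j)).natDegree ≤ n - j :=
      natDegree_pow_le.trans (by nlinarith)
    omega
  calc _ ≤ n * 1 := Nat.mul_le_mul h2 h1
    _ = n := mul_one n

/-! ### Lipschitz dependence of a Bernstein polynomial on its operator argument. -/

section NormedRing

variable {A : Type*} [NormedRing A] [NormOneClass A]

/-- The factors are exchanged one at a time in fixed order, so `a` and `b` need not commute; they
will be two different Hamiltonians. -/
theorem norm_pow_sub_pow_le {a b : A} (ha : ‖a‖ ≤ 1) (hb : ‖b‖ ≤ 1) (m : ℕ) :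
    ‖a ^ m - b ^ m‖ ≤ m * ‖a - b‖ := by
  induction m with
  | zero => simp
  | succ m ih =>
    have h : a ^ (m + 1) - b ^ (m + 1) = a ^ m * (a - b) + (a ^ m - b ^ m) * b := by
      rw [pow_succ, pow_succ]; noncomm_ring
    have ham : ‖a ^ m‖ ≤ 1 := (norm_pow_le a m).trans (pow_le_one₀ (norm_nonneg _) ha)
    rw [h]
    calc _ ≤ ‖a ^ m‖ * ‖a - b‖ + ‖a ^ m - b ^ m‖ * ‖b‖ :=
          (norm_add_le _ _).trans (add_le_add (norm_mul_le _ _) (norm_mul_le _ _))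
      _ ≤ 1 * ‖a - b‖ + (m * ‖a - b‖) * 1 := by gcongr
      _ = _ := by push_cast; ring

theorem norm_pow_mul_pow_sub_le {a b : A} (ha : ‖a‖ ≤ 1) (hb : ‖b‖ ≤ 1) (ha' : ‖1 - a‖ ≤ 1)
    (hb' : ‖1 - b‖ ≤ 1) (i j : ℕ) :
    ‖a ^ i * (1 - a) ^ j - b ^ i * (1 - b) ^ j‖ ≤ (i + j : ℕ) * ‖a - b‖ := by
  have h : a ^ i * (1 - a) ^ j - b ^ i * (1 - b) ^ j
      = a ^ i * ((1 - a) ^ j - (1 - b) ^ j) + (a ^ i - b ^ i) * (1 - b) ^ j := by noncomm_ring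
  have h1 : ‖a ^ i‖ ≤ 1 := (norm_pow_le a i).trans (pow_le_one₀ (norm_nonneg _) ha)
  have h2 : ‖(1 - b) ^ j‖ ≤ 1 := (norm_pow_le _ j).trans (pow_le_one₀ (norm_nonneg _) hb')
  have h3 := norm_pow_sub_pow_le ha' hb' j
  have h4 := norm_pow_sub_pow_le ha hb i
  rw [sub_sub_sub_cancel_left, norm_sub_rev b] at h3
  rw [h]
  calc _ ≤ ‖a ^ i‖ * ‖(1 - a) ^ j - (1 - b) ^ j‖ + ‖a ^ i - b ^ i‖ * ‖(1 - b) ^ j‖ :=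
        (norm_add_le _ _).trans (add_le_add (norm_mul_le _ _) (norm_mul_le _ _))
    _ ≤ 1 * (j * ‖a - b‖) + (i * ‖a - b‖) * 1 := by gcongr
    _ = _ := by push_cast; ring

theorem norm_rescale_le [NormedAlgebra ℝ A] {r : ℝ} (hr : 0 < r) {a : A} (ha : ‖a‖ ≤ r) :
    ‖(1 / (2 * r)) • a + (1 / 2 : ℝ) • (1 : A)‖ ≤ 1 := by
  refine (norm_add_le _ _).trans ?_
  rw [norm_smul, norm_smul, norm_one, Real.norm_of_nonneg (by positivity),
    Real.norm_of_nonneg (by norm_num)]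
  calc 1 / (2 * r) * ‖a‖ + 1 / 2 * 1 ≤ 1 / (2 * r) * r + 1 / 2 * 1 := by gcongr
    _ = 1 := by field_simp; norm_num

/-- In the Bernstein basis the coefficients are values of `f`, hence at most `S`. After rescaling,
both `u` and `1 - u` are contractions, so each `u ^ j (1 - u) ^ (n - j)` is `n`-Lipschitz in `u`;
the binomial coefficients sum to `2 ^ n` and the rescaling contributes `1 / (2 r)`. -/
theorem norm_aeval_bernsteinApprox_sub_le [NormedAlgebra ℝ A] {f : ℝ → ℝ} {r S : ℝ} (hr : 0 < r)
    (hf : ∀ x ∈ Set.Icc (-r) r, |f x| ≤ S) (n : ℕ) {a b : A} (ha : ‖a‖ ≤ r) (hb : ‖b‖ ≤ r) :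
    ‖aeval a (bernsteinApprox f r n) - aeval b (bernsteinApprox f r n)‖
      ≤ S * (n * 2 ^ n / (2 * r)) * ‖a - b‖ := by
  have hexp : ∀ c : A, aeval c (bernsteinApprox f r n) = ∑ j ∈ Finset.range (n + 1),
      (f (2 * r * (j / n) - r) * n.choose j) •
        (((1 / (2 * r)) • c + (1 / 2 : ℝ) • (1 : A)) ^ j *
          (1 - ((1 / (2 * r)) • c + (1 / 2 : ℝ) • (1 : A))) ^ (n - j)) := by
    intro c
    rw [bernsteinApprox, map_sum]
    refine Finset.sum_congr rfl fun j _ => ?_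
    rw [map_mul, aeval_C, aeval_comp, bernsteinPolynomial]
    simp only [map_add, map_mul, aeval_C, aeval_X, map_natCast, map_pow, map_sub, map_one]
    rw [Algebra.algebraMap_eq_smul_one, Algebra.algebraMap_eq_smul_one,
      Algebra.algebraMap_eq_smul_one, smul_mul_assoc, one_mul, smul_mul_assoc, one_mul, mul_smul,
      mul_assoc _ (_ ^ j), ← nsmul_eq_mul, Nat.cast_smul_eq_nsmul]
  -- The complement is the rescaling of `-c`, so `norm_rescale_le` covers it too.
  have hneg : ∀ c : A, 1 - ((1 / (2 * r)) • c + (1 / 2 : ℝ) • (1 : A))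
      = (1 / (2 * r)) • (-c) + (1 / 2 : ℝ) • (1 : A) := by
    intro c
    have : (1 : A) = (1 / 2 : ℝ) • (1 : A) + (1 / 2 : ℝ) • (1 : A) := by
      rw [← add_smul]; norm_num
    nth_rw 1 [this]
    rw [smul_neg]; abel
  have hS : 0 ≤ S := (abs_nonneg _).trans (hf 0 ⟨by linarith, hr.le⟩)
  have hdiff : ‖((1 / (2 * r)) • a + (1 / 2 : ℝ) • (1 : A)) -
      ((1 / (2 * r)) • b + (1 / 2 : ℝ) • (1 : A))‖ = 1 / (2 * r) * ‖a - b‖ := by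
    rw [add_sub_add_right_eq_sub, ← smul_sub, norm_smul, Real.norm_of_nonneg (by positivity)]
  rw [hexp, hexp, ← Finset.sum_sub_distrib]
  calc _ ≤ ∑ j ∈ Finset.range (n + 1), S * n.choose j * (n * (1 / (2 * r) * ‖a - b‖)) := by
        refine norm_sum_le_of_le _ fun j hj => ?_
        rw [← smul_sub, norm_smul, Real.norm_eq_abs, abs_mul, Nat.abs_cast]
        have hj' := Finset.mem_range_succ_iff.1 hj
        have h := norm_pow_mul_pow_sub_le (norm_rescale_le hr ha) (norm_rescale_le hr hb)
          (by rw [hneg]; exact norm_rescale_le hr (by rwa [norm_neg]))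
          (by rw [hneg]; exact norm_rescale_le hr (by rwa [norm_neg])) j (n - j)
        rw [hdiff, Nat.add_sub_cancel' hj'] at h
        have := hf _ (node_mem_Icc hr hj)
        gcongr
    _ = _ := by
        have h2 : ∑ j ∈ Finset.range (n + 1), (n.choose j : ℝ) = 2 ^ n := by
          exact_mod_cast Nat.sum_range_choose n
        rw [← Finset.sum_mul, ← Finset.mul_sum, h2]
        ring

end NormedRing

end Bernstein

/-! ### Integrals of bounded functions. -/

section Integral

theorem abs_integral_le_of_abs_le {Y : Type*} [MeasurableSpace Y] {μ : Measure Y}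
    [IsProbabilityMeasure μ] {f : Y → ℝ} {c : ℝ} (h : ∀ x, |f x| ≤ c) : |∫ x, f x ∂μ| ≤ c := by
  have := norm_integral_le_of_norm_le_const (μ := μ) (f := f) (C := c) (Eventually.of_forall h)
  simpa using this

theorem abs_integral_sub_integral_le {Y : Type*} [MeasurableSpace Y] {μ : Measure Y}
    [IsProbabilityMeasure μ] {f g : Y → ℝ} {c : ℝ} (hf : Integrable f μ) (hg : Integrable g μ)
    (h : ∀ x, |f x - g x| ≤ c) : |(∫ x, f x ∂μ) - ∫ x, g x ∂μ| ≤ c := by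
  rw [← integral_sub hf hg]
  exact abs_integral_le_of_abs_le h

theorem integrable_of_abs_le {Y : Type*} [MeasurableSpace Y] {μ : Measure Y}
    [IsFiniteMeasure μ] {f : Y → ℝ} {c : ℝ} (hf : Measurable f) (h : ∀ x, |f x| ≤ c) :
    Integrable f μ :=
  Integrable.of_bound hf.aestronglyMeasurable c (Eventually.of_forall h)

theorem iSup_abs_nonneg {X : Type*} (f : X → ℝ) : 0 ≤ ⨆ x, |f x| :=
  Real.iSup_nonneg fun _ => abs_nonneg _

end Integral

/-! ### The Lipschitz norm and the dual metric. -/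

section LipNorm

variable {X : Type*} [MetricSpace X]

theorem lipNorm_le {g : X → ℝ} {A B : ℝ} (hA : 0 ≤ A) (hB : 0 ≤ B) (hgA : ∀ x, |g x| ≤ A)
    (hgB : ∀ x y, |g x - g y| ≤ B * dist x y) : lipNorm g ≤ A + B :=
  add_le_add (Real.iSup_le hgA hA)
    (Real.iSup_le (fun p => div_le_of_le_mul₀ dist_nonneg hB (hgB p.1 p.2)) hB)

theorem IsLip.continuous {f : X → ℝ} (hf : IsLip f) : Continuous f := hf.choose_spec.continuous

/-- A real supremum of an unbounded family is `0` by convention; `IsLip` supplies the boundedness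
that makes the supremum a genuine Lipschitz constant. -/
theorem IsLip.abs_sub_le {f : X → ℝ} (hf : IsLip f) (x y : X) :
    |f x - f y| ≤ (⨆ p : X × X, |f p.1 - f p.2| / dist p.1 p.2) * dist x y := by
  obtain ⟨K, hK⟩ := hf
  have hb : BddAbove (Set.range fun p : X × X => |f p.1 - f p.2| / dist p.1 p.2) := by
    refine ⟨K, ?_⟩
    rintro _ ⟨p, rfl⟩
    refine div_le_of_le_mul₀ dist_nonneg K.2 ?_
    rw [← Real.dist_eq]
    exact hK.dist_le_mul p.1 p.2
  rcases eq_or_ne x y with rfl | h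
  · simp
  · rw [← div_le_iff₀ (dist_pos.2 h)]
    exact le_ciSup hb (x, y)

theorem iSup_lip_nonneg (f : X → ℝ) : 0 ≤ ⨆ p : X × X, |f p.1 - f p.2| / dist p.1 p.2 :=
  Real.iSup_nonneg fun _ => div_nonneg (abs_nonneg _) dist_nonneg

theorem IsLip.abs_le [CompactSpace X] {f : X → ℝ} (hf : IsLip f) (x : X) : |f x| ≤ ⨆ x, |f x| :=
  le_ciSup (isCompact_range hf.continuous.abs).bddAbove x

theorem IsLip.of_abs_sub_le {f : X → ℝ} {K : ℝ} (hK : 0 ≤ K)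
    (h : ∀ x y, |f x - f y| ≤ K * dist x y) : IsLip f :=
  ⟨⟨K, hK⟩, LipschitzWith.of_dist_le_mul fun x y => by rw [Real.dist_eq]; exact h x y⟩

theorem IsLip.abs_le_one [CompactSpace X] {f : X → ℝ} (hf : IsLip f) (h : lipNorm f ≤ 1)
    (x : X) : |f x| ≤ 1 :=
  (hf.abs_le x).trans ((le_add_of_nonneg_right (iSup_lip_nonneg f)).trans h)

theorem IsLip.abs_sub_le_dist {f : X → ℝ} (hf : IsLip f) (h : lipNorm f ≤ 1) (x y : X) :
    |f x - f y| ≤ 1 * dist x y :=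
  (hf.abs_sub_le x y).trans (mul_le_mul_of_nonneg_right
    ((le_add_of_nonneg_left (iSup_abs_nonneg f)).trans h) dist_nonneg)

theorem dw_nonneg [MeasurableSpace X] (μ ν : ProbabilityMeasure X) : 0 ≤ dw μ ν :=
  Real.sSup_nonneg (by rintro _ ⟨f, -, -, rfl⟩; exact abs_nonneg _)

/-- By homogeneity: `g / (A + B)` lies in the unit ball over which the supremum is taken. The
supremum is finite because test functions are bounded by `1`. -/
theorem abs_integral_sub_le_dw [MeasurableSpace X] [CompactSpace X] (μ ν : ProbabilityMeasure X)
    {g : X → ℝ} {A B : ℝ} (hA : 0 ≤ A) (hB : 0 ≤ B) (hgA : ∀ x, |g x| ≤ A)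
    (hgB : ∀ x y, |g x - g y| ≤ B * dist x y) :
    |(∫ x, g x ∂(μ : Measure X)) - ∫ x, g x ∂(ν : Measure X)| ≤ (A + B) * dw μ ν := by
  rcases (add_nonneg hA hB).eq_or_lt with h0 | hpos
  · have hA0 : A = 0 := by linarith
    have hg0 : g = fun _ => 0 := funext fun x => abs_nonpos_iff.1 (hA0 ▸ hgA x)
    simp [hg0, ← h0]
  · have hbdd : BddAbove {t | ∃ f : X → ℝ, IsLip f ∧ lipNorm f ≤ 1 ∧
        t = |(∫ x, f x ∂(μ : Measure X)) - ∫ x, f x ∂(ν : Measure X)|} := by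
      refine ⟨1 + 1, ?_⟩
      rintro _ ⟨f, hf, hf1, rfl⟩
      exact (abs_sub _ _).trans (add_le_add (abs_integral_le_of_abs_le (hf.abs_le_one hf1))
        (abs_integral_le_of_abs_le (hf.abs_le_one hf1)))
    have hmem : |(∫ x, g x / (A + B) ∂(μ : Measure X)) - ∫ x, g x / (A + B) ∂(ν : Measure X)|
        ≤ dw μ ν := by
      have hlip : ∀ x y, |g x / (A + B) - g y / (A + B)| ≤ B / (A + B) * dist x y := by
        intro x y
        rw [← sub_div, abs_div, abs_of_pos hpos, div_mul_eq_mul_div]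
        exact div_le_div_of_nonneg_right (hgB x y) hpos.le
      refine le_csSup hbdd ⟨_, IsLip.of_abs_sub_le (div_nonneg hB hpos.le) hlip, ?_, rfl⟩
      refine (lipNorm_le (div_nonneg hA hpos.le) (div_nonneg hB hpos.le) ?_ hlip).trans_eq ?_
      · intro x
        rw [abs_div, abs_of_pos hpos]
        exact div_le_div_of_nonneg_right (hgA x) hpos.le
      · field_simp
    rw [integral_div, integral_div, ← sub_div, abs_div, abs_of_pos hpos, div_le_iff₀ hpos] at hmem
    linarith

end LipNorm

/-! ### Weak convergence implies convergence of the dual metric. -/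

section Convergence

variable {C : ℝ}

/-- Bernstein approximation bounds `dw` by finitely many continuous test functions. -/
theorem dw_le_bernstein (hC : 0 ≤ C) (μ ν : ProbabilityMeasure (Set.Icc (-C) C)) {n : ℕ}
    (hn : 0 < n) :
    dw μ ν ≤ 2 * ((C + 1) / Real.sqrt n) + ∑ j ∈ Finset.range (n + 1),
      |(∫ x, (bernsteinPolynomial ℝ n j).eval (1 / (2 * (C + 1)) * (x : ℝ) + 1 / 2)
          ∂(μ : Measure (Set.Icc (-C) C))) -
        ∫ x, (bernsteinPolynomial ℝ n j).eval (1 / (2 * (C + 1)) * (x : ℝ) + 1 / 2)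
          ∂(ν : Measure (Set.Icc (-C) C))| := by
  have hCC : -C ≤ C := by linarith
  -- The Bernstein interval needs positive radius and `C` may vanish, hence `C + 1`.
  have hr : 0 < C + 1 := by linarith
  refine Real.sSup_le ?_ (add_nonneg (by positivity)
    (Finset.sum_nonneg fun _ _ => abs_nonneg _))
  rintro _ ⟨f, hf, hf1, rfl⟩
  -- Projecting onto the interval extends `f` to the line without increasing its sup or Lipschitz
  -- bound.
  set F : ℝ → ℝ := fun t => f (Set.projIcc (-C) C hCC t) with hF
  have hFf : ∀ x : Set.Icc (-C) C, F x = f x := fun x => by simp [hF]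
  have hF1 : ∀ t, |F t| ≤ 1 := fun t => hf.abs_le_one hf1 _
  have hFL : ∀ s t, |F s - F t| ≤ 1 * |s - t| := by
    intro s t
    refine (hf.abs_sub_le_dist hf1 _ _).trans ?_
    gcongr
    have := (LipschitzWith.projIcc hCC).dist_le_mul s t
    simpa [Real.dist_eq] using this
  have hcont : ∀ j, Continuous fun x : Set.Icc (-C) C =>
      (bernsteinPolynomial ℝ n j).eval (1 / (2 * (C + 1)) * (x : ℝ) + 1 / 2) := by
    intro j
    exact (bernsteinPolynomial ℝ n j).continuous.comp (by fun_prop)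
  have hint : ∀ (ρ : ProbabilityMeasure (Set.Icc (-C) C)) (g : Set.Icc (-C) C → ℝ),
      Continuous g → Integrable g (ρ : Measure (Set.Icc (-C) C)) := by
    intro ρ g hg
    obtain ⟨c, hc⟩ := (isCompact_range hg.abs).bddAbove
    exact integrable_of_abs_le hg.measurable fun x => hc ⟨x, rfl⟩
  have happ : ∀ ρ : ProbabilityMeasure (Set.Icc (-C) C),
      |(∫ x, f x ∂(ρ : Measure (Set.Icc (-C) C))) - ∑ j ∈ Finset.range (n + 1),
        F (2 * (C + 1) * (j / n) - (C + 1)) *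
        ∫ x, (bernsteinPolynomial ℝ n j).eval (1 / (2 * (C + 1)) * (x : ℝ) + 1 / 2)
          ∂(ρ : Measure (Set.Icc (-C) C))| ≤ (C + 1) / Real.sqrt n := by
    intro ρ
    simp only [← integral_const_mul]
    rw [← integral_finsetSum _ fun j _ => (hint ρ _ (hcont j)).const_mul _]
    refine abs_integral_sub_integral_le (hint ρ _ hf.continuous)
      (integrable_finsetSum _ fun j _ => (hint ρ _ (hcont j)).const_mul _) fun x => ?_
    rw [← hFf, ← eval_bernsteinApprox]
    have := abs_sub_eval_bernsteinApprox_le hr zero_le_one (fun s _ t _ => hFL s t) hn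
      (x := x) ⟨by linarith [x.2.1], by linarith [x.2.2]⟩
    rwa [one_mul] at this
  have h1 := happ μ
  have h2 := happ ν
  set bμ : ℕ → ℝ := fun j => ∫ x : Set.Icc (-C) C,
    (bernsteinPolynomial ℝ n j).eval (1 / (2 * (C + 1)) * (x : ℝ) + 1 / 2) ∂μ
  set bν : ℕ → ℝ := fun j => ∫ x : Set.Icc (-C) C,
    (bernsteinPolynomial ℝ n j).eval (1 / (2 * (C + 1)) * (x : ℝ) + 1 / 2) ∂ν
  -- The test function enters only through coefficients bounded by `1`, which makes the estimate
  -- uniform over the unit ball.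
  have h3 : |(∑ j ∈ Finset.range (n + 1), F (2 * (C + 1) * (j / n) - (C + 1)) * bμ j) -
      ∑ j ∈ Finset.range (n + 1), F (2 * (C + 1) * (j / n) - (C + 1)) * bν j|
      ≤ ∑ j ∈ Finset.range (n + 1), |bμ j - bν j| := by
    rw [← Finset.sum_sub_distrib]
    refine (Finset.abs_sum_le_sum_abs _ _).trans (Finset.sum_le_sum fun j _ => ?_)
    rw [← mul_sub, abs_mul]
    exact mul_le_of_le_one_left (abs_nonneg _) (hF1 _)
  rw [abs_le] at h1 h2 h3 ⊢
  constructor <;> linarith [h1.1, h1.2, h2.1, h2.2, h3.1, h3.2]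

/-- The degree is fixed first, to make the approximation error less than `ε / 2`; only finitely many
integrals of continuous functions then have to converge. -/
theorem tendsto_dw (hC : 0 ≤ C) {ν : ProbabilityMeasure (Set.Icc (-C) C)}
    {νs : ℕ → ProbabilityMeasure (Set.Icc (-C) C)} (hν : Tendsto νs atTop (𝓝 ν)) :
    Tendsto (fun α => dw (νs α) ν) atTop (𝓝 0) := by
  rw [Metric.tendsto_atTop]
  intro ε hε
  have hsqrt : Tendsto (fun n : ℕ => 2 * ((C + 1) / Real.sqrt n)) atTop (𝓝 (2 * 0)) :=
    (((Real.tendsto_sqrt_atTop.comp tendsto_natCast_atTop_atTop).const_div_atTop _)).const_mul 2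
  rw [mul_zero] at hsqrt
  obtain ⟨n, hn, hn0⟩ := ((hsqrt.eventually_lt_const (half_pos hε)).and
    (eventually_gt_atTop 0)).exists
  have hsum : Tendsto (fun α => ∑ j ∈ Finset.range (n + 1),
      |(∫ x, (bernsteinPolynomial ℝ n j).eval (1 / (2 * (C + 1)) * (x : ℝ) + 1 / 2)
          ∂(νs α : Measure (Set.Icc (-C) C))) -
        ∫ x, (bernsteinPolynomial ℝ n j).eval (1 / (2 * (C + 1)) * (x : ℝ) + 1 / 2)
          ∂(ν : Measure (Set.Icc (-C) C))|) atTop (𝓝 (∑ j ∈ Finset.range (n + 1), 0)) := by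
    refine tendsto_finsetSum _ fun j _ => ?_
    have hcont : Continuous fun x : Set.Icc (-C) C =>
        (bernsteinPolynomial ℝ n j).eval (1 / (2 * (C + 1)) * (x : ℝ) + 1 / 2) :=
      (bernsteinPolynomial ℝ n j).continuous.comp (by fun_prop)
    have := (ProbabilityMeasure.tendsto_iff_forall_integral_tendsto.1 hν)
      (BoundedContinuousFunction.mkOfCompact ⟨_, hcont⟩)
    simp only [BoundedContinuousFunction.mkOfCompact_apply, ContinuousMap.coe_mk] at this
    rw [← abs_zero, ← sub_self (∫ x : Set.Icc (-C) C,
      (bernsteinPolynomial ℝ n j).eval (1 / (2 * (C + 1)) * (x : ℝ) + 1 / 2) ∂ν)]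
    exact (this.sub_const _).abs
  rw [Finset.sum_const_zero] at hsum
  obtain ⟨N, hN⟩ := eventually_atTop.1 (hsum.eventually_lt_const (half_pos hε))
  refine ⟨N, fun α hα => ?_⟩
  rw [Real.dist_eq, sub_zero, abs_of_nonneg (dw_nonneg _ _)]
  have := dw_le_bernstein hC (νs α) ν hn0
  linarith [hN α hα]

end Convergence

/-! ### Product measures with site-dependent laws. -/

section ProductMeasure

variable {V X : Type*} [MeasurableSpace X]

/-- The product of a family of probability measures. -/
def familyLaw (μ : V → ProbabilityMeasure X) : Measure (V → X) :=
  Measure.infinitePi fun i => (μ i : Measure X)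

instance (μ : V → ProbabilityMeasure X) : IsProbabilityMeasure (familyLaw μ) := by
  unfold familyLaw; infer_instance

theorem measurable_update_prod [DecidableEq V] (x : V) :
    Measurable fun p : (V → X) × X => Function.update p.1 x p.2 := by
  refine measurable_pi_iff.2 fun i => ?_
  rcases eq_or_ne i x with rfl | hi
  · simpa using measurable_snd
  · simp only [Function.update_of_ne hi]
    exact (measurable_pi_apply i).comp measurable_fst

/-- Resampling one coordinate of a product measure. -/
theorem map_update_familyLaw [DecidableEq V] (μ : V → ProbabilityMeasure X) (x : V)
    (ρ : ProbabilityMeasure X) :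
    ((familyLaw μ).prod (ρ : Measure X)).map (fun p => Function.update p.1 x p.2)
      = familyLaw (Function.update μ x ρ) := by
  refine Measure.eq_infinitePi (μ := fun i => ((Function.update μ x ρ i : ProbabilityMeasure X) :
    Measure X)) fun s t ht => ?_
  rw [Measure.map_apply (measurable_update_prod x)
    (MeasurableSet.pi s.countable_toSet fun i _ => ht i)]
  by_cases hx : x ∈ s
  · have hpre : (fun p : (V → X) × X => Function.update p.1 x p.2) ⁻¹' (Set.pi s t)
        = (Set.pi (s.erase x : Finset V) t) ×ˢ t x := by
      ext p
      simp only [Set.mem_preimage, Set.mem_pi, Set.mem_prod, Finset.mem_coe, Finset.mem_erase]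
      constructor
      · intro h
        refine ⟨fun i hi => ?_, by simpa using h x hx⟩
        have := h i hi.2
        rwa [Function.update_of_ne hi.1] at this
      · rintro ⟨h1, h2⟩ i hi
        rcases eq_or_ne i x with rfl | hne
        · simpa using h2
        · rw [Function.update_of_ne hne]; exact h1 i ⟨hne, hi⟩
    rw [hpre, Measure.prod_prod, familyLaw, Measure.infinitePi_pi _ fun i _ => ht i,
      ← Finset.prod_erase_mul _ _ hx, Function.update_self]
    congr 1
    refine Finset.prod_congr rfl fun i hi => ?_
    rw [Function.update_of_ne (Finset.ne_of_mem_erase hi)]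
  · have hpre : (fun p : (V → X) × X => Function.update p.1 x p.2) ⁻¹' (Set.pi s t)
        = (Set.pi s t) ×ˢ Set.univ := by
      ext p
      simp only [Set.mem_preimage, Set.mem_pi, Set.mem_prod, Finset.mem_coe, Set.mem_univ,
        and_true]
      refine forall₂_congr fun i hi => ?_
      rw [Function.update_of_ne (ne_of_mem_of_not_mem hi hx)]
    rw [hpre, Measure.prod_prod, familyLaw, Measure.infinitePi_pi _ fun i _ => ht i, measure_univ,
      mul_one]
    refine Finset.prod_congr rfl fun i hi => ?_
    rw [Function.update_of_ne (ne_of_mem_of_not_mem hi hx)]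

theorem integral_familyLaw_update [DecidableEq V] (μ : V → ProbabilityMeasure X) (x : V)
    (ρ : ProbabilityMeasure X) {F : (V → X) → ℝ} {A : ℝ} (hF : Measurable F)
    (hA : ∀ ω, |F ω| ≤ A) :
    ∫ ω, F ω ∂(familyLaw (Function.update μ x ρ))
      = ∫ ω, ∫ t, F (Function.update ω x t) ∂(ρ : Measure X) ∂(familyLaw μ) := by
  rw [← map_update_familyLaw, integral_map (measurable_update_prod x).aemeasurable
    hF.aestronglyMeasurable, integral_prod]
  exact integrable_of_abs_le (hF.comp (measurable_update_prod x)) fun p => hA _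

/-- The integral of a function of finitely many coordinates depends only on their laws. -/
theorem integral_familyLaw_congr {μ μ' : V → ProbabilityMeasure X} {S : Finset V}
    (h : ∀ i ∈ S, μ i = μ' i) {F : (V → X) → ℝ} (hF : Measurable F)
    (hFS : DependsOn F (S : Set V)) :
    ∫ ω, F ω ∂(familyLaw μ) = ∫ ω, F ω ∂(familyLaw μ') := by
  classical
  rcases isEmpty_or_nonempty V with hV | ⟨⟨v⟩⟩
  · rw [Subsingleton.elim μ μ']
  obtain ⟨x₀⟩ : Nonempty X := (μ v).nonempty
  -- Filling in a constant outside `S` factors `F` through the restriction to `S`, whose law is a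
  -- finite product involving only the laws on `S`.
  set e : (S → X) → V → X := fun τ i => if hi : i ∈ S then τ ⟨i, hi⟩ else x₀ with he
  have hem : Measurable e := by
    refine measurable_pi_iff.2 fun i => ?_
    by_cases hi : i ∈ S
    · simpa [he, hi] using measurable_pi_apply _
    · simp [he, hi]
  have hfac : ∀ ω, F ω = (F ∘ e) (S.restrict ω) := fun ω => hFS fun i hi => by
    simp [he, Finset.mem_coe.1 hi]
  have key : ∀ ρ : V → ProbabilityMeasure X, ∫ ω, F ω ∂(familyLaw ρ)
      = ∫ τ, (F ∘ e) τ ∂(Measure.pi fun i : S => (ρ i : Measure X)) := by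
    intro ρ
    rw [← Measure.infinitePi_map_restrict (μ := fun i => (ρ i : Measure X)),
      integral_map (Finset.measurable_restrict S).aemeasurable
        (hF.comp hem).aestronglyMeasurable]
    exact integral_congr_ae (Eventually.of_forall hfac)
  rw [key, key]
  congr 2
  funext i
  rw [h i i.2]

end ProductMeasure

/-! ### Replacing the single-site law site by site. -/

section Telescoping

variable {V X : Type*} [MetricSpace X] [CompactSpace X] [MeasurableSpace X] [BorelSpace X]

/-- Two consecutive mixed laws differ at one site. With all other coordinates frozen, `F` is a test
function of that coordinate alone, and `abs_integral_sub_le_dw` applies. -/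
theorem abs_integral_piecewise_sub_le [DecidableEq V] (ν' ν : ProbabilityMeasure X) (S : Finset V)
    {F : (V → X) → ℝ} {A B : ℝ} (hA : 0 ≤ A) (hB : 0 ≤ B) (hF : Measurable F)
    (hFA : ∀ ω, |F ω| ≤ A)
    (hFB : ∀ ω x s t, |F (Function.update ω x s) - F (Function.update ω x t)| ≤ B * dist s t) :
    |(∫ ω, F ω ∂(familyLaw (S.piecewise (fun _ => ν') fun _ => ν))) -
        ∫ ω, F ω ∂(familyLaw fun _ => ν)| ≤ S.card * ((A + B) * dw ν' ν) := by
  induction S using Finset.induction_on with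
  | empty => simp
  | insert x S hx ih =>
    set μ : V → ProbabilityMeasure X := S.piecewise (fun _ => ν') fun _ => ν with hμ
    have hsec : ∀ ρ : ProbabilityMeasure X, Integrable
        (fun ω => ∫ t, F (Function.update ω x t) ∂(ρ : Measure X)) (familyLaw μ) := by
      intro ρ
      have hi : Integrable (fun p : (V → X) × X => F (Function.update p.1 x p.2))
          ((familyLaw μ).prod (ρ : Measure X)) :=
        integrable_of_abs_le (hF.comp (measurable_update_prod x)) fun p => hFA _
      exact hi.integral_prod_left
    -- As `x ∉ S`, resampling `x` from `ν` does not change the law; both sides of the step become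
    -- averages over the same outer measure.
    have hself : ∫ ω, F ω ∂(familyLaw μ)
        = ∫ ω, ∫ t, F (Function.update ω x t) ∂(ν : Measure X) ∂(familyLaw μ) := by
      rw [← integral_familyLaw_update μ x ν hF hFA]
      congr 2
      rw [eq_comm, Function.update_eq_self_iff, hμ, Finset.piecewise_eq_of_notMem _ _ _ hx]
    have hstep : |(∫ ω, F ω ∂(familyLaw ((insert x S).piecewise (fun _ => ν') fun _ => ν))) -
        ∫ ω, F ω ∂(familyLaw μ)| ≤ (A + B) * dw ν' ν := by
      rw [Finset.piecewise_insert, ← hμ, integral_familyLaw_update μ x ν' hF hFA, hself]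
      exact abs_integral_sub_integral_le (hsec ν') (hsec ν) fun ω =>
        abs_integral_sub_le_dw ν' ν hA hB (fun t => hFA _) (fun s t => hFB ω x s t)
    rw [Finset.card_insert_of_notMem hx]
    push_cast
    rw [abs_le] at ih hstep ⊢
    constructor <;> linarith [ih.1, ih.2, hstep.1, hstep.2]

/-- Changing the single-site law in the expectation of a function of finitely many coordinates. -/
theorem abs_integral_familyLaw_sub_le (ν' ν : ProbabilityMeasure X) {S : Finset V}
    {F : (V → X) → ℝ} {A B : ℝ} (hA : 0 ≤ A) (hB : 0 ≤ B) (hF : Measurable F)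
    (hFS : DependsOn F (S : Set V)) (hFA : ∀ ω, |F ω| ≤ A)
    (hFB : ∀ [DecidableEq V], ∀ ω x s t,
      |F (Function.update ω x s) - F (Function.update ω x t)| ≤ B * dist s t) :
    |(∫ ω, F ω ∂(familyLaw fun _ => ν')) - ∫ ω, F ω ∂(familyLaw fun _ => ν)|
      ≤ S.card * ((A + B) * dw ν' ν) := by
  classical
  have := abs_integral_piecewise_sub_le ν' ν S hA hB hF hFA hFB
  rwa [integral_familyLaw_congr (μ' := fun _ => ν') (fun i hi => by simp [hi]) hF hFS] at this

end Telescoping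

/-! ### Finite propagation and dependence on a single site. -/

section Locality

variable {V : Type*} (G : SimpleGraph V) [G.LocallyFinite] {k : ℕ} (o : V)

open Classical in
/-- The ball of radius `m` around `o`, as a finite set of vertices. -/
def graphBall : ℕ → Finset V
  | 0 => {o}
  | m + 1 => graphBall m ∪ (graphBall m).biUnion fun x => G.neighborFinset x

/-- Each step adds at most `k` vertices per vertex. This crude growth rate is enough, since `4 (k +
1) ≤ k ^ 3` is all that `exists_degree` needs. -/
theorem card_graphBall_le (hG : G.IsRegularOfDegree k) (m : ℕ) :
    (graphBall G o m).card ≤ (k + 1) ^ m := by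
  classical
  induction m with
  | zero => simp [graphBall]
  | succ m ih =>
    have h : ((graphBall G o m).biUnion fun x => G.neighborFinset x).card
        ≤ (graphBall G o m).card * k := Finset.card_biUnion_le_card_mul _ _ _ fun x _ => by
      rw [SimpleGraph.card_neighborFinset_eq_degree]; exact (hG x).le
    rw [graphBall]
    calc _ ≤ (graphBall G o m).card + (graphBall G o m).card * k :=
          (Finset.card_union_le _ _).trans (by convert Nat.add_le_add_left h _)
      _ = (graphBall G o m).card * (k + 1) := by ring
      _ ≤ (k + 1) ^ m * (k + 1) := Nat.mul_le_mul_right _ ih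
      _ = (k + 1) ^ (m + 1) := (pow_succ _ _).symm

theorem graphBall_mono : Monotone (graphBall G o) :=
  monotone_nat_of_le_succ fun m => by
    classical
    rw [graphBall]; exact Finset.subset_union_left

variable {G} {C : ℝ} (hG : IsBetheLattice G k)

theorem hamiltonian_pow_succ_apply (ω : Config V C) (m : ℕ) (ψ : ell2 V) :
    (hamiltonian G hG ω ^ (m + 1)) ψ = hamiltonian G hG ω ((hamiltonian G hG ω ^ m) ψ) := by
  rw [pow_succ', mul_apply_eq_comp]

theorem hamiltonian_pow_delta_eq_zero (ω : Config V C) (m : ℕ) {x : V}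
    (hx : x ∉ graphBall G o m) : (hamiltonian G hG ω ^ m) (delta o) x = 0 := by
  classical
  induction m generalizing x with
  | zero => exact delta_apply_of_ne (by simpa [graphBall] using hx)
  | succ m ih =>
    simp only [graphBall, Finset.mem_union, Finset.mem_biUnion, SimpleGraph.mem_neighborFinset,
      not_or, not_exists, not_and] at hx
    rw [hamiltonian_pow_succ_apply, hamiltonian_apply, ih hx.1, mul_zero, add_zero]
    refine Finset.sum_eq_zero fun y hy => ih fun hy' => hx.2 y hy' ?_
    exact ((SimpleGraph.mem_neighborFinset _ _ _).1 hy).symm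

/-- `H_ω ^ m δ_o` with `m ≤ n + 1` depends only on the potential in the ball of radius `n`. -/
theorem hamiltonian_pow_delta_congr {ω ω' : Config V C} {n : ℕ}
    (h : ∀ x ∈ graphBall G o n, ω x = ω' x) {m : ℕ} (hm : m ≤ n + 1) :
    (hamiltonian G hG ω ^ m) (delta o) = (hamiltonian G hG ω' ^ m) (delta o) := by
  induction m with
  | zero => rfl
  | succ m ih =>
    rw [hamiltonian_pow_succ_apply, hamiltonian_pow_succ_apply, ih (by omega)]
    ext x
    rw [hamiltonian_apply, hamiltonian_apply]
    -- The potential multiplies a vector supported in the ball of radius `m`, so the power `m + 1`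
    -- sees no sites beyond that radius. This saves one radius in the later count.
    by_cases hx : x ∈ graphBall G o m
    · rw [h x (graphBall_mono G o (by omega) hx)]
    · rw [hamiltonian_pow_delta_eq_zero o hG ω' m hx, mul_zero, mul_zero]

theorem measurable_hamiltonian_pow_delta (m : ℕ) (x : V) :
    Measurable fun ω : Config V C => (hamiltonian G hG ω ^ m) (delta o) x := by
  induction m generalizing x with
  | zero => exact measurable_const
  | succ m ih =>
    simp only [hamiltonian_pow_succ_apply, hamiltonian_apply]
    refine (Finset.measurable_fun_sum _ fun y _ => ih y).add (Measurable.mul ?_ (ih x))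
    exact Complex.measurable_ofReal.comp (measurable_subtype_coe.comp (measurable_pi_apply x))

theorem siteProj_norm_le (x : V) (ψ : ell2 V) : ‖siteProj x ψ‖ ≤ ‖ψ‖ := by
  rw [siteProj, InnerProductSpace.rankOne_apply, norm_smul, norm_delta, mul_one, inner_delta]
  exact lp.norm_apply_le_norm (by simp) ψ x

/-- The difference is `(s - t) π_x`, and `π_x` is a contraction. -/
theorem norm_hamiltonian_update_sub_le [DecidableEq V] (ω : Config V C) (x : V)
    (s t : Set.Icc (-C) C) :
    ‖hamiltonian G hG (Function.update ω x s) - hamiltonian G hG (Function.update ω x t)‖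
      ≤ dist s t := by
  refine ContinuousLinearMap.opNorm_le_bound _ dist_nonneg fun ψ => ?_
  have h : (hamiltonian G hG (Function.update ω x s) - hamiltonian G hG (Function.update ω x t)) ψ
      = (((s : ℝ) - (t : ℝ) : ℝ) : ℂ) • siteProj x ψ := by
    ext y
    rw [sub_apply, lp.coeFn_sub, Pi.sub_apply, hamiltonian_apply,
      hamiltonian_apply, siteProj, InnerProductSpace.rankOne_apply, inner_delta, lp.coeFn_smul,
      Pi.smul_apply, lp.coeFn_smul, Pi.smul_apply, smul_eq_mul, smul_eq_mul]
    rcases eq_or_ne y x with rfl | hy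
    · rw [Function.update_self, Function.update_self, delta_apply_self]
      push_cast
      ring
    · rw [Function.update_of_ne hy, Function.update_of_ne hy, delta_apply_of_ne hy]
      ring
  rw [h, norm_smul, Complex.norm_real, Subtype.dist_eq, Real.dist_eq, Real.norm_eq_abs]
  gcongr
  exact siteProj_norm_le x ψ

end Locality

/-! ### Comparison of functions of an operator. -/

section FunctionalCalculus

variable {E : Type*} [NormedAddCommGroup E] [InnerProductSpace ℂ E] [CompleteSpace E]

theorem norm_opFun_sub_opFun_le {H : E →L[ℂ] E} {f g : ℝ → ℝ} {s : Set ℝ} {c : ℝ} (hc : 0 ≤ c)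
    (hs : spectrum ℝ H ⊆ s) (hf : ContinuousOn f s) (hg : ContinuousOn g s)
    (h : ∀ x ∈ s, |f x - g x| ≤ c) : ‖opFun f H - opFun g H‖ ≤ c := by
  rw [opFun, opFun, ← cfc_sub f g H (hf.mono hs) (hg.mono hs)]
  exact norm_cfc_le hc fun x hx => h x (hs hx)

theorem opFun_polynomial {H : E →L[ℂ] E} (hH : IsSelfAdjoint H) (p : Polynomial ℝ) :
    opFun (fun x => p.eval x) H = Polynomial.aeval H p :=
  cfc_polynomial p H hH

end FunctionalCalculus

/-! ### The local spectral average and its polynomial approximation. -/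

section SiteAverage

variable {V : Type*} {G : SimpleGraph V} [G.LocallyFinite] {k : ℕ} (hG : IsBetheLattice G k)
  (o : V) {C : ℝ}

/-- The spectral average `⟨δ_o, f(H_ω) δ_o⟩` as a real number. -/
def siteAverage (f : ℝ → ℝ) (ω : Config V C) : ℝ :=
  (inner ℂ (delta o) (opFun f (hamiltonian G hG ω) (delta o))).re

theorem localTrace_eq_siteAverage (f : ℝ → ℝ) (ω : Config V C) :
    localTrace G hG o f ω = (siteAverage hG o f ω : ℂ) := by
  rw [localTrace, trace_siteProj, siteAverage, eq_comm]
  have hsa : IsSelfAdjoint (opFun f (hamiltonian G hG ω)) := cfc_predicate f _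
  rw [← Complex.conj_eq_iff_re, inner_conj_symm]
  nth_rw 1 [← (ContinuousLinearMap.isSelfAdjoint_iff'.1 hsa)]
  exact ContinuousLinearMap.adjoint_inner_left _ _ _

theorem dos_eq_integral_siteAverage (ν : ProbabilityMeasure (Set.Icc (-C) C)) (f : ℝ → ℝ) :
    dos G hG o ν f = ((∫ ω, siteAverage hG o f ω ∂(familyLaw fun _ => ν) : ℝ) : ℂ) := by
  simp only [dos, localTrace_eq_siteAverage]
  exact integral_ofReal

theorem abs_re_inner_delta_le (T : ell2 V →L[ℂ] ell2 V) :
    |(inner ℂ (delta o) (T (delta o))).re| ≤ ‖T‖ := by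
  refine (Complex.abs_re_le_norm _).trans ((norm_inner_le_norm _ _).trans ?_)
  have := T.le_opNorm (delta o)
  rw [norm_delta, mul_one] at this
  rwa [norm_delta, one_mul]

theorem abs_siteAverage_sub_le (hk : 3 ≤ k) (hC : 0 ≤ C) {f g : ℝ → ℝ} {c : ℝ} (hc : 0 ≤ c)
    (hf : ContinuousOn f (energies k C)) (hg : ContinuousOn g (energies k C))
    (h : ∀ x ∈ energies k C, |f x - g x| ≤ c) (ω : Config V C) :
    |siteAverage hG o f ω - siteAverage hG o g ω| ≤ c := by
  have hsp := spectrum_real_hamiltonian_subset G hk hG hC ω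
  have hsub : (siteAverage hG o f ω - siteAverage hG o g ω) =
      (inner ℂ (delta o) ((opFun f (hamiltonian G hG ω) - opFun g (hamiltonian G hG ω))
        (delta o))).re := by
    rw [sub_apply, inner_sub_right, Complex.sub_re]; rfl
  rw [hsub]
  exact (abs_re_inner_delta_le o _).trans (norm_opFun_sub_opFun_le hc hsp hf hg h)

theorem abs_siteAverage_le (hk : 3 ≤ k) (hC : 0 ≤ C) {f : ℝ → ℝ} {c : ℝ} (hc : 0 ≤ c)
    (h : ∀ x ∈ energies k C, |f x| ≤ c) (ω : Config V C) : |siteAverage hG o f ω| ≤ c :=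
  (abs_re_inner_delta_le o _).trans (norm_cfc_le hc fun x hx =>
    h x (spectrum_real_hamiltonian_subset G hk hG hC ω hx))

theorem siteAverage_polynomial (p : Polynomial ℝ) (ω : Config V C) :
    siteAverage hG o (fun x => p.eval x) ω =
      (inner ℂ (delta o) (Polynomial.aeval (hamiltonian G hG ω) p (delta o))).re := by
  rw [siteAverage, opFun_polynomial (isSelfAdjoint_hamiltonian G hG ω)]
  rfl

/-- Measurability and locality are read off from this finite combination of diagonal entries of
powers. -/
theorem siteAverage_polynomial_eq_sum (p : Polynomial ℝ) (ω : Config V C) :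
    siteAverage hG o (fun x => p.eval x) ω = ∑ i ∈ Finset.range (p.natDegree + 1),
      p.coeff i * ((hamiltonian G hG ω ^ i) (delta o) o).re := by
  rw [siteAverage_polynomial, Polynomial.aeval_eq_sum_range, sum_apply,
    inner_sum, Complex.re_sum]
  refine Finset.sum_congr rfl fun i _ => ?_
  rw [smul_apply, inner_smul_right_eq_smul, Complex.smul_re, inner_delta,
    smul_eq_mul]

theorem measurable_siteAverage_polynomial (p : Polynomial ℝ) :
    Measurable fun ω : Config V C => siteAverage hG o (fun x => p.eval x) ω := by
  simp only [siteAverage_polynomial_eq_sum]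
  exact Finset.measurable_fun_sum _ fun i _ => measurable_const.mul
    (Complex.measurable_re.comp (measurable_hamiltonian_pow_delta o hG i o))

theorem dependsOn_siteAverage_polynomial {p : Polynomial ℝ} {n : ℕ} (hp : p.natDegree ≤ n + 1) :
    DependsOn (fun ω : Config V C => siteAverage hG o (fun x => p.eval x) ω)
      (graphBall G o n : Set V) := by
  intro ω ω' h
  simp only [siteAverage_polynomial_eq_sum]
  refine Finset.sum_congr rfl fun i hi => ?_
  rw [hamiltonian_pow_delta_congr o hG h
    ((Finset.mem_range_succ_iff.1 hi).trans hp)]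

theorem abs_siteAverage_bernstein_update_sub_le [DecidableEq V] (hk : 3 ≤ k) (hC : 0 ≤ C)
    {f : ℝ → ℝ} {S : ℝ} (hr : 0 < rB k C) (hf : ∀ x ∈ energies k C, |f x| ≤ S) (n : ℕ)
    (ω : Config V C) (x : V) (s t : Set.Icc (-C) C) :
    |siteAverage hG o (fun x => (bernsteinApprox f (rB k C) n).eval x) (Function.update ω x s) -
      siteAverage hG o (fun x => (bernsteinApprox f (rB k C) n).eval x) (Function.update ω x t)|
      ≤ S * (n * 2 ^ n / (2 * rB k C)) * dist s t := by
  have := hG.isTree.connected.nonempty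
  have hS : 0 ≤ S := (abs_nonneg _).trans (hf 0 ⟨by linarith, hr.le⟩)
  rw [siteAverage_polynomial, siteAverage_polynomial, ← Complex.sub_re, ← inner_sub_right,
    ← sub_apply]
  refine (abs_re_inner_delta_le o _).trans ((norm_aeval_bernsteinApprox_sub_le hr hf n
    (norm_hamiltonian_le G hk hG hC _) (norm_hamiltonian_le G hk hG hC _)).trans ?_)
  gcongr
  exact norm_hamiltonian_update_sub_le hG ω x s t

theorem two_le_rB (hk : 3 ≤ k) (hC : 0 ≤ C) : 2 ≤ rB k C := by
  have hk' : (3 : ℝ) ≤ k := by exact_mod_cast hk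
  have : 1 ≤ Real.sqrt ((k : ℝ) - 1) := Real.one_le_sqrt.2 (by linarith)
  unfold rB
  linarith

variable {f : ℝ → ℝ} {S L : ℝ}

theorem abs_siteAverage_sub_bernstein_le (hk : 3 ≤ k) (hC : 0 ≤ C) (hL : 0 ≤ L)
    (hfL : ∀ x ∈ energies k C, ∀ y ∈ energies k C, |f x - f y| ≤ L * |x - y|)
    {n : ℕ} (hn : 0 < n) (ω : Config V C) :
    |siteAverage hG o f ω -
      siteAverage hG o (fun x => (bernsteinApprox f (rB k C) n).eval x) ω|
      ≤ L * rB k C / Real.sqrt n := by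
  have hr : 0 < rB k C := by linarith [two_le_rB hk hC]
  have hfc : ContinuousOn f (energies k C) := by
    refine LipschitzOnWith.continuousOn (K := ⟨L, hL⟩) (LipschitzOnWith.of_dist_le_mul ?_)
    intro x hx y hy
    exact hfL x hx y hy
  exact abs_siteAverage_sub_le hG o hk hC (by positivity) hfc
    (Polynomial.continuous _).continuousOn
    (fun x hx => abs_sub_eval_bernsteinApprox_le hr hL hfL hn hx) ω

/-- The average is a pointwise limit of polynomial averages, so no measurability of the functional
calculus itself is required. -/
theorem measurable_siteAverage (hk : 3 ≤ k) (hC : 0 ≤ C) (hL : 0 ≤ L)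
    (hfL : ∀ x ∈ energies k C, ∀ y ∈ energies k C, |f x - f y| ≤ L * |x - y|) :
    Measurable fun ω : Config V C => siteAverage hG o f ω := by
  refine measurable_of_tendsto_metrizable (f := fun n : ℕ => fun ω : Config V C =>
    siteAverage hG o (fun x => (bernsteinApprox f (rB k C) n).eval x) ω)
    (fun n => measurable_siteAverage_polynomial hG o _) (tendsto_pi_nhds.2 fun ω => ?_)
  have h0 : Tendsto (fun n : ℕ => L * rB k C / Real.sqrt n) atTop (𝓝 0) :=
    (Real.tendsto_sqrt_atTop.comp tendsto_natCast_atTop_atTop).const_div_atTop _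
  refine tendsto_iff_dist_tendsto_zero.2 (squeeze_zero' (Eventually.of_forall fun _ =>
    dist_nonneg) ?_ h0)
  filter_upwards [eventually_gt_atTop 0] with n hn
  rw [dist_comm, Real.dist_eq]
  exact abs_siteAverage_sub_bernstein_le hG o hk hC hL hfL hn ω

/-- The basic estimate, with the degree `m + 1` of the polynomial approximation left free. -/
theorem abs_integral_siteAverage_sub_le (hk : 3 ≤ k) (hC : 0 ≤ C) (hL : 0 ≤ L)
    (hfS : ∀ x ∈ energies k C, |f x| ≤ S)
    (hfL : ∀ x ∈ energies k C, ∀ y ∈ energies k C, |f x - f y| ≤ L * |x - y|)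
    (ν' ν : ProbabilityMeasure (Set.Icc (-C) C)) (m : ℕ) :
    |(∫ ω, siteAverage hG o f ω ∂(familyLaw fun _ => ν')) -
        ∫ ω, siteAverage hG o f ω ∂(familyLaw fun _ => ν)|
      ≤ 2 * (L * rB k C / Real.sqrt (m + 1 : ℕ)) + ((k : ℝ) + 1) ^ m *
        (S * (1 + (m + 1 : ℕ) * 2 ^ (m + 1) / (2 * rB k C)) * dw ν' ν) := by
  have hr : 0 < rB k C := by linarith [two_le_rB hk hC]
  have hS : 0 ≤ S := (abs_nonneg _).trans (hfS 0 ⟨by linarith, hr.le⟩)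
  have hPS : ∀ ω : Config V C, |siteAverage hG o
      (fun x => (bernsteinApprox f (rB k C) (m + 1)).eval x) ω| ≤ S :=
    abs_siteAverage_le hG o hk hC hS fun x hx => abs_eval_bernsteinApprox_le hr hfS _ hx
  have hpm := measurable_siteAverage_polynomial hG o (C := C) (bernsteinApprox f (rB k C) (m + 1))
  have happ : ∀ ρ : ProbabilityMeasure (Set.Icc (-C) C),
      |(∫ ω, siteAverage hG o f ω ∂(familyLaw fun _ => ρ)) - ∫ ω, siteAverage hG o
        (fun x => (bernsteinApprox f (rB k C) (m + 1)).eval x) ω ∂(familyLaw fun _ : V => ρ)|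
        ≤ L * rB k C / Real.sqrt (m + 1 : ℕ) := fun ρ =>
    abs_integral_sub_integral_le
      (integrable_of_abs_le (measurable_siteAverage hG o hk hC hL hfL)
        (abs_siteAverage_le hG o hk hC hS hfS))
      (integrable_of_abs_le hpm hPS)
      (abs_siteAverage_sub_bernstein_le hG o hk hC hL hfL m.succ_pos)
  -- Sup bound `S`, Lipschitz constant `S n 2 ^ n / (2 r)` with `n = m + 1`, and the ball of radius
  -- `m` as set of sites.
  have hdiff := abs_integral_familyLaw_sub_le ν' ν hS
    (mul_nonneg hS (by positivity : 0 ≤ ((m + 1 : ℕ) : ℝ) * 2 ^ (m + 1) / (2 * rB k C))) hpm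
    (dependsOn_siteAverage_polynomial hG o (natDegree_bernsteinApprox_le f (rB k C) (m + 1))) hPS
    (fun ω x s t => abs_siteAverage_bernstein_update_sub_le hG o hk hC hr hfS (m + 1) ω x s t)
  have hcard : ((graphBall G o m).card : ℝ) ≤ ((k : ℝ) + 1) ^ m := by
    exact_mod_cast card_graphBall_le G o hG.regular m
  have hdw := dw_nonneg ν' ν
  have hdiff' := hdiff.trans (mul_le_mul_of_nonneg_right hcard (mul_nonneg (add_nonneg hS
    (mul_nonneg hS (by positivity))) hdw))
  rw [← mul_one_add S] at hdiff'
  have h1 := happ ν'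
  have h2 := happ ν
  rw [abs_le] at h1 h2 hdiff' ⊢
  constructor <;> linarith [h1.1, h1.2, h2.1, h2.2, hdiff'.1, hdiff'.2]

end SiteAverage

/-! ### Choice of the degree. -/

section Optimization

theorem xi0_pos : 0 < xi0 := by unfold xi0; positivity

theorem xi0_lt_one : xi0 < 1 := by
  unfold xi0
  have := Real.exp_pos 1
  rw [div_lt_one (by positivity)]
  linarith

theorem one_le_bernsteinConst : 1 ≤ bernsteinConst := by
  have : (2 : ℝ) ≤ Real.sqrt 6 := Real.le_sqrt_of_sq_le (by norm_num)
  unfold bernsteinConst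
  rw [one_le_div (by norm_num)]
  linarith

/-- The choice of the degree of the approximation. -/
theorem exists_degree {k : ℕ} (hk : 3 ≤ k) {r η : ℝ} (hr : 2 ≤ r) (hη : 0 < η)
    (hηk : η ≤ Real.exp (-(3 * Real.log k / xi0))) :
    ∃ m : ℕ, 1 / Real.sqrt (m + 1 : ℕ)
        ≤ 2 * Real.sqrt (Real.log k) / Real.sqrt (Real.log (η ^ (-xi0))) ∧
      ((k : ℝ) + 1) ^ m * ((1 + (m + 1 : ℕ) * 2 ^ (m + 1) / (2 * r)) * η)
        ≤ 2 / Real.sqrt (Real.log (η ^ (-xi0))) := by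
  have hk' : (3 : ℝ) ≤ k := by exact_mod_cast hk
  have hlog : 0 < Real.log k := Real.log_pos (by linarith)
  have hx0 := xi0_pos
  set T := Real.log (η ^ (-xi0)) with hT
  have hTη : T = -xi0 * Real.log η := Real.log_rpow hη _
  have hlogη : Real.log η ≤ -(3 * Real.log k / xi0) := by
    rwa [← Real.log_le_iff_le_exp hη] at hηk
  have hT3 : 3 * Real.log k ≤ T := by
    rw [hTη]
    have := mul_le_mul_of_nonneg_left hlogη hx0.le
    rw [mul_neg, mul_div_cancel₀ _ hx0.ne'] at this
    linarith
  have hTpos : 0 < T := by linarith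
  -- In fact `η = exp (-T / ξ₀)`; only `0 < ξ₀ < 1` matters.
  have hηT : η ≤ Real.exp (-T) := by
    rw [← Real.log_le_iff_le_exp hη, hTη]
    have : Real.log η < 0 := hlogη.trans_lt (by simp only [neg_neg_iff_pos]; positivity)
    nlinarith [xi0_lt_one]
  have hsT : 0 < Real.sqrt T := Real.sqrt_pos.2 hTpos
  have hτ : 0 < T / (4 * Real.log k) := by positivity
  -- The lower bound on `m + 1` controls the approximation error, the upper bound on `m` the number
  -- of sites. The `4` is the square of the factor `2` in the first claim.
  obtain ⟨m, hm⟩ : ∃ m, ⌈T / (4 * Real.log k)⌉₊ = m + 1 :=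
    Nat.exists_eq_succ_of_ne_zero (Nat.ceil_pos.2 hτ).ne'
  have hm1 : T / (4 * Real.log k) ≤ (m + 1 : ℕ) := hm ▸ Nat.le_ceil _
  have hm2 : (m : ℝ) ≤ T / (4 * Real.log k) := by
    have := Nat.ceil_lt_add_one hτ.le
    rw [hm] at this
    push_cast at this
    linarith
  refine ⟨m, ?_, ?_⟩
  · have hsm : 0 < Real.sqrt (m + 1 : ℕ) := Real.sqrt_pos.2 (by positivity)
    rw [div_le_div_iff₀ hsm hsT, one_mul]
    have h4 : (2 : ℝ) = Real.sqrt 4 := by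
      rw [show (4 : ℝ) = 2 ^ 2 by norm_num, Real.sqrt_sq (by norm_num)]
    rw [h4, ← Real.sqrt_mul (by norm_num), ← Real.sqrt_mul (by positivity)]
    refine Real.sqrt_le_sqrt ?_
    rwa [div_le_iff₀ (by positivity), mul_comm] at hm1
  · have hpow : 1 + ((m + 1 : ℕ) : ℝ) * 2 ^ (m + 1) / (2 * r) ≤ 3 / 2 * 4 ^ m := by
      have h1 : ((m + 1 : ℕ) : ℝ) ≤ 2 ^ m := by exact_mod_cast Nat.lt_two_pow_self
      have h2 : (1 : ℝ) ≤ 4 ^ m := one_le_pow₀ (by norm_num)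
      have h3 : ((m + 1 : ℕ) : ℝ) * 2 ^ (m + 1) / (2 * r) ≤ 2 ^ m * 2 ^ (m + 1) / (2 * 2) := by
        gcongr
      have h4 : (2 : ℝ) ^ m * 2 ^ (m + 1) / (2 * 2) = 1 / 2 * 4 ^ m := by
        rw [show (4 : ℝ) = 2 * 2 by norm_num, mul_pow, pow_succ]; ring
      linarith
    have hk3 : ((k : ℝ) + 1) ^ m * 4 ^ m ≤ Real.exp (3 * T / 4) := by
      have hkk : ((k : ℝ) + 1) * 4 ≤ (k : ℝ) ^ 3 := by 
        nlinarith [mul_nonneg (sub_nonneg.2 hk') (sub_nonneg.2 hk')]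
      have hklog : (k : ℝ) ^ 3 = Real.exp (3 * Real.log k) := by
        rw [show (3 : ℝ) * Real.log k = ((3 : ℕ) : ℝ) * Real.log k by norm_num, Real.exp_nat_mul,
          Real.exp_log (by linarith)]
      calc ((k : ℝ) + 1) ^ m * 4 ^ m = (((k : ℝ) + 1) * 4) ^ m := (mul_pow _ _ _).symm
        _ ≤ ((k : ℝ) ^ 3) ^ m := by gcongr
        _ = Real.exp (m * (3 * Real.log k)) := by rw [hklog, Real.exp_nat_mul]
        _ ≤ Real.exp (3 * T / 4) := by
          rw [Real.exp_le_exp]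
          rw [le_div_iff₀ (by positivity)] at hm2
          linarith
    -- The exponents balance: `3 T / 4` from the sites and the Lipschitz constant, `-T` from `η`,
    -- and `T / 4` for `√T`. The factor `3 / 2` left over is below the allowed `2`.
    have hsqrt : Real.sqrt T ≤ Real.exp (T / 4) := by
      have h1 : T ≤ Real.exp (T / 2) := by
        have := Real.quadratic_le_exp_of_nonneg (x := T / 2) (by positivity)
        nlinarith [sq_nonneg (T / 2 - 1)]
      refine Real.sqrt_le_iff.2 ⟨(Real.exp_pos _).le, h1.trans_eq ?_⟩
      rw [← Real.exp_nat_mul]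
      congr 1
      push_cast
      ring
    rw [le_div_iff₀ hsT]
    calc _ ≤ ((k : ℝ) + 1) ^ m * ((3 / 2 * 4 ^ m) * Real.exp (-T)) * Real.exp (T / 4) := by gcongr
      _ = 3 / 2 * (((k : ℝ) + 1) ^ m * 4 ^ m) * Real.exp (-T) * Real.exp (T / 4) := by ring
      _ ≤ 3 / 2 * Real.exp (3 * T / 4) * Real.exp (-T) * Real.exp (T / 4) := by gcongr
      _ = 3 / 2 := by
        rw [mul_assoc, mul_assoc, ← Real.exp_add, ← Real.exp_add]
        ring_nf
        simp
      _ ≤ 2 := by norm_num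

end Optimization

/-! ### The estimate for the density of states. -/

section Main

variable {V : Type*} {G : SimpleGraph V} [G.LocallyFinite] {k : ℕ} (hG : IsBetheLattice G k)
  (o : V) {C : ℝ} {f : ℝ → ℝ}

theorem IsLip.abs_sub_le_on_energies (hf : IsLip fun E : energies k C => f E) :
    ∀ x ∈ energies k C, ∀ y ∈ energies k C, |f x - f y| ≤
      (⨆ p : energies k C × energies k C, |f p.1 - f p.2| / dist p.1 p.2) * |x - y| :=
  fun x hx y hy => hf.abs_sub_le ⟨x, hx⟩ ⟨y, hy⟩

theorem IsLip.abs_le_on_energies (hf : IsLip fun E : energies k C => f E) :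
    ∀ x ∈ energies k C, |f x| ≤ ⨆ E : energies k C, |f E| :=
  fun x hx => hf.abs_le ⟨x, hx⟩

theorem integrable_localTrace (hk : 3 ≤ k) (hC : 0 ≤ C) (hf : IsLip fun E : energies k C => f E)
    (μ : ProbabilityMeasure (Set.Icc (-C) C)) :
    Integrable (fun ω : Config V C => localTrace G hG o f ω) (productLaw V μ) := by
  simp only [localTrace_eq_siteAverage]
  have h : Integrable (fun ω : Config V C => siteAverage hG o f ω) (familyLaw fun _ => μ) :=
    integrable_of_abs_le
      (measurable_siteAverage hG o hk hC (iSup_lip_nonneg fun E : energies k C => f E)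
        hf.abs_sub_le_on_energies)
      (abs_siteAverage_le hG o hk hC (iSup_abs_nonneg _) hf.abs_le_on_energies)
  exact h.ofReal

theorem norm_dos_sub_le (hk : 3 ≤ k) (hC : 0 ≤ C) (hf : IsLip fun E : energies k C => f E)
    (ν' ν : ProbabilityMeasure (Set.Icc (-C) C))
    (hη : dw ν' ν ≤ Real.exp (-(3 * Real.log k / xi0))) :
    ‖dos G hG o ν' f - dos G hG o ν f‖ ≤
      gammaB k C * lipNorm (fun E : energies k C => f E) /
        Real.sqrt (Real.log (dw ν' ν ^ (-xi0))) := by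
  have hr2 := two_le_rB hk hC
  have hbase := abs_integral_siteAverage_sub_le hG o hk hC
    (iSup_lip_nonneg fun E : energies k C => f E) hf.abs_le_on_energies
    hf.abs_sub_le_on_energies ν' ν
  rw [dos_eq_integral_siteAverage, dos_eq_integral_siteAverage, ← Complex.ofReal_sub,
    Complex.norm_real, Real.norm_eq_abs]
  set L := ⨆ p : energies k C × energies k C, |f p.1 - f p.2| / dist p.1 p.2 with hL
  set S := ⨆ E : energies k C, |f E| with hS
  have hL0 : 0 ≤ L := iSup_lip_nonneg fun E : energies k C => f E
  have hS0 : 0 ≤ S := iSup_abs_nonneg _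
  have hnorm : lipNorm (fun E : energies k C => f E) = S + L := rfl
  rw [hnorm]
  rcases (dw_nonneg ν' ν).eq_or_lt with h0 | hpos
  -- For `η = 0` the conventions for `0 ^ (-ξ₀)`, `log 0` and division by `0` turn the right-hand
  -- side into `0`. The basic estimate then holds without its second term for every degree, and the
  -- degree tends to infinity.
  · rw [← h0, Real.zero_rpow (neg_ne_zero.2 xi0_pos.ne'), Real.log_zero, Real.sqrt_zero, div_zero]
    have hlim : Tendsto (fun m : ℕ => 2 * (L * rB k C / Real.sqrt (m + 1 : ℕ))) atTop
        (𝓝 (2 * 0)) :=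
      ((Real.tendsto_sqrt_atTop.comp (tendsto_natCast_atTop_atTop.comp
        (tendsto_add_atTop_nat 1))).const_div_atTop _).const_mul 2
    rw [mul_zero] at hlim
    refine ge_of_tendsto' hlim fun m => (hbase m).trans_eq ?_
    rw [← h0, mul_zero, mul_zero, add_zero]
  · obtain ⟨m, hm1, hm2⟩ := exists_degree hk hr2 hpos hη
    refine (hbase m).trans ?_
    set D := Real.sqrt (Real.log (dw ν' ν ^ (-xi0))) with hD
    have hD0 : 0 ≤ D := Real.sqrt_nonneg _
    have hs : 0 ≤ Real.sqrt (Real.log k) := Real.sqrt_nonneg _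
    -- The approximation rate `L r / √n` already gives this with `1` in place of `c_b`, so `c_b ≥ 1`
    -- suffices.
    have h1 : 2 * (L * rB k C / Real.sqrt (m + 1 : ℕ))
        ≤ 2 * ((S + L) * rB k C * (2 * Real.sqrt (Real.log k) * bernsteinConst / D)) := by
      rw [div_eq_mul_one_div]
      have hLS : L ≤ S + L := le_add_of_nonneg_left hS0
      have hc : 2 * Real.sqrt (Real.log k) / D
          ≤ 2 * Real.sqrt (Real.log k) * bernsteinConst / D := by
        exact div_le_div_of_nonneg_right
          (le_mul_of_one_le_right (by positivity) one_le_bernsteinConst) hD0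
      have := hm1.trans hc
      gcongr
    have h2 : ((k : ℝ) + 1) ^ m * (S * (1 + (m + 1 : ℕ) * 2 ^ (m + 1) / (2 * rB k C)) * dw ν' ν)
        ≤ (S + L) * (2 / D) := by
      calc _ = S * (((k : ℝ) + 1) ^ m *
            ((1 + (m + 1 : ℕ) * 2 ^ (m + 1) / (2 * rB k C)) * dw ν' ν)) := by ring
        _ ≤ S * (2 / D) := by gcongr
        _ ≤ (S + L) * (2 / D) := by gcongr; exact le_add_of_nonneg_right hL0
    refine (add_le_add h1 h2).trans_eq ?_
    unfold gammaB
    ring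

end Main

end BetheAnderson

end

theorem theorem6p3 {V : Type*} (G : SimpleGraph V) [G.LocallyFinite] (k : ℕ) (hk : 3 ≤ k)
    (hG : BetheAnderson.IsBetheLattice G k) (o : V) (C : ℝ)
    (ν : ProbabilityMeasure (Set.Icc (-C) C))
    (νs : ℕ → ProbabilityMeasure (Set.Icc (-C) C))
    (hν : Tendsto νs atTop (𝓝 ν)) :
    -- the spectral averages are well defined
    (∀ ω : BetheAnderson.Config V C,
      IsSelfAdjoint (BetheAnderson.hamiltonian G hG ω) ∧
      spectrum ℂ (BetheAnderson.hamiltonian G hG ω)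
        ⊆ Complex.ofReal '' BetheAnderson.energies k C) ∧
    (∀ f : ℝ → ℝ,
      BetheAnderson.IsLip (fun E : BetheAnderson.energies k C => f E) →
      ∀ μ : ProbabilityMeasure (Set.Icc (-C) C),
        Integrable (fun ω : BetheAnderson.Config V C => BetheAnderson.localTrace G hG o f ω)
          (BetheAnderson.productLaw V μ)) ∧
    -- an admissible threshold exists
    (∃ αB : ℕ, ∀ α ≥ αB,
      BetheAnderson.dw (νs α) ν ≤ Real.exp (-(3 * Real.log k / BetheAnderson.xi0))) ∧
    -- the estimate holds beyond every admissible threshold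
    (∀ αB : ℕ,
      (∀ α ≥ αB,
        BetheAnderson.dw (νs α) ν ≤ Real.exp (-(3 * Real.log k / BetheAnderson.xi0))) →
      ∀ f : ℝ → ℝ,
        BetheAnderson.IsLip (fun E : BetheAnderson.energies k C => f E) →
        ∀ α ≥ αB,
          ‖BetheAnderson.dos G hG o (νs α) f - BetheAnderson.dos G hG o ν f‖
            ≤ BetheAnderson.gammaB k C *
                BetheAnderson.lipNorm (fun E : BetheAnderson.energies k C => f E) /
              Real.sqrt (Real.log (BetheAnderson.dw (νs α) ν ^ (-BetheAnderson.xi0)))) := by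
  -- A probability measure on `[-C, C]` exists only if the interval is nonempty.
  have hC : 0 ≤ C := by
    obtain ⟨x⟩ := ν.nonempty
    linarith [x.2.1, x.2.2]
  refine ⟨fun ω => ⟨BetheAnderson.isSelfAdjoint_hamiltonian G hG ω,
    BetheAnderson.spectrum_hamiltonian_subset G hk hG hC ω⟩,
    fun f hf μ => BetheAnderson.integrable_localTrace hG o hk hC hf μ, ?_,
    fun αB hαB f hf α hα => BetheAnderson.norm_dos_sub_le hG o hk hC hf _ _ (hαB α hα)⟩
  exact eventually_atTop.1
    (((BetheAnderson.tendsto_dw hC hν).eventually_lt_const (Real.exp_pos _)).mono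
      fun _ h => h.le)
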